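/- Let $\mathbb K$ be a field of characteristic zero, let $\epsilon\in\{1,-1\}$, and let $A1_\epsilon$ be the $\mathbb Z_2\times\mathbb Z_2$-graded Lie algebra with basis $Q_0=H,\,Q_1,\,Q_2,\,Q_3$ of degrees $(0,0),(1,0),(0,1),(1,1)$, commuting factor $(-1)^{\alpha\cdot\beta}$ with $\alpha\cdot\beta=\alpha_1\beta_2-\alpha_2\beta_1$, and relations $[H,Q_k]=0$, $\{Q_1,Q_2\}=Q_3$, $\{Q_2,Q_3\}=\epsilon Q_1$, $\{Q_3,Q_1\}=Q_2$. Let $\mathcal U=\mathcal U(A1_\epsilon)$ be its universal enveloping algebra, $C=(C^{\mu\nu})=\mathrm{diag}(1,\epsilon,1,1)$ the inverse of its invariant bilinear form, $c=\sum_{\mu,\nu} C^{\mu\nu}Q_\mu Q_\nu$ the Casimir element and $y=c-H^2$. For a chord diagram $D$ on the oriented circle, $w(D)\in\mathcal U$ is obtained by cutting the circle at a point that is not an endpoint of a chord and summing, over all labellings of the endpoints by $0,1,2,3$, the product of the entries of $C$ at the labels of the two ends of each chord, of the commuting factors of the labels of each pair of intersecting chords, and of the basis elements $Q_\mu$ multiplied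 along the cut circle. Extend $w$ linearly to formal linear combinations of chord diagrams. Let $s(D)=\sum_a (D-a)$ (sum over all chords $a$ of $D$), let $\theta(D)$ be the connected sum of $D$ with the diagram with a single chord, and for $D$ with $n$ chords let $\phi(D)=\sum_{m=0}^n\frac{(-1)^m}{m!}\theta^m s^m(D)$. The unframed weight system is $\bar w=w\circ\phi$. Let $a$ be a chord of $D$, let $b_1,\dots,b_k$ be the distinct chords of $D$ that intersect $a$, and put $D_a=D-a$, $D_{a,i}=D-a-b_i$, $D_{a,ij}=D-a-b_i-b_j$. Draw $D$ with $a$ vertical, so that each $b_i$ has a left end and a right end. Let $D^{\parallel}_{a,ij}$ (resp. $D^{\times}_{a,ij}$) be $D_{a,ij}$ together with the two chords that join the left ends of $b_i$ and $b_j$ and the right ends of $b_i$ and $b_j$ (resp. the left end of $b_i$ to the right end of $b_j$, and the right end of $b_i$ to the left end of $b_j$). Let $D^{\ell r}_{a,ij}, D^{r\ell}_{a,ij}, D^{\ell\ell}_{a,ij}, D^{rr}_{a,ij}$ be $D_{a,ij}$ together with the one chord that joins the end of $b_i$ named by the first superscript to the end of $b_j$ named by the second. Set $$\Gamma_{a,ij}=D^{\parallel}_{a,ij}-D^{\times}_{a,ij},\qquad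 \Lambda_{a,ij}=D^{\ell r}_{a,ij}+D^{r\ell}_{a,ij}-D^{\ell\ell}_{a,ij}-D^{rr}_{a,ij}.$$ Then, for every choice of the points at which the diagrams are cut, $$\bar w(D)=-\epsilon\Big(k\,\bar w(D_a)+y\sum_{i}\bar w(D_{a,i})-\sum_{i<j}\bar w(\Gamma_{a,ij})+y\sum_{i<j}\bar w(\Lambda_{a,ij})\Big).$$ -/

import Mathlib

/-! ### The color Lie algebra `A1_ε` and its universal enveloping algebra

The basis `H, Q₁, Q₂, Q₃` of `A1_ε` is indexed by `0, 1, 2, 3 : Fin 4`. -/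

namespace A1

/-- The `ℤ₂ × ℤ₂`-degrees of `H, Q₁, Q₂, Q₃`. -/
def deg : Fin 4 → ZMod 2 × ZMod 2 :=
  ![(0, 0), (1, 0), (0, 1), (1, 1)]

/-- The commuting factor `(-1)^(α₁β₂ - α₂β₁)` at the degrees of two basis elements. -/
def phase (K : Type*) [Field K] (a b : Fin 4) : K :=
  (-1) ^ ((deg a).1 * (deg b).2 - (deg a).2 * (deg b).1).val

/-- The graded bracket of two basis elements: `[H, Q_k] = 0`, `{Q₁, Q₂} = Q₃`,
`{Q₂, Q₃} = ε Q₁`, `{Q₃, Q₁} = Q₂`, and `[Q_k, Q_k] = 0`; an element of `A1_ε` is given by its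
coordinates. -/
def bracket {K : Type*} [Field K] (ε : K) : Fin 4 → Fin 4 → (Fin 4 → K)
  | 1, 2 => Pi.single 3 1
  | 2, 1 => Pi.single 3 1
  | 2, 3 => Pi.single 1 ε
  | 3, 2 => Pi.single 1 ε
  | 3, 1 => Pi.single 2 1
  | 1, 3 => Pi.single 2 1
  | _, _ => 0

/-- The matrix `diag(1, ε, 1, 1)` of the invariant bilinear form `B` of `A1_ε`. -/
def B {K : Type*} [Field K] (ε : K) : Matrix (Fin 4) (Fin 4) K :=
  Matrix.diagonal ![1, ε, 1, 1]

/-- The inverse of the invariant form; for `ε = ±1` it has the same matrix. -/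
def C {K : Type*} [Field K] (ε : K) : Matrix (Fin 4) (Fin 4) K :=
  Matrix.diagonal ![1, ε, 1, 1]

theorem B_mul_C {K : Type*} [Field K] (ε : K) (hε : ε = 1 ∨ ε = -1) : B ε * C ε = 1 := by
  rw [B, C, Matrix.diagonal_mul_diagonal, ← Matrix.diagonal_one]
  congr 1
  funext i
  rcases hε with rfl | rfl <;> fin_cases i <;> simp

/-- The relations `X ⊗ Y = S(X, Y) + f(X, Y)` of the enveloping algebra on basis elements, where
`S(X, Y) = (commuting factor) Y ⊗ X` and `f` is the graded bracket. The tensor algebra of the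
four-dimensional space `A1_ε` is the free algebra on the basis. -/
inductive Rel {K : Type*} [Field K] (ε : K) :
    FreeAlgebra K (Fin 4) → FreeAlgebra K (Fin 4) → Prop
  | swap (a b : Fin 4) :
      Rel ε (FreeAlgebra.ι K a * FreeAlgebra.ι K b)
        (phase K a b • (FreeAlgebra.ι K b * FreeAlgebra.ι K a) +
          ∑ c, bracket ε a b c • FreeAlgebra.ι K c)

/-- The universal enveloping algebra `𝒰(A1_ε)`. -/
abbrev U {K : Type*} [Field K] (ε : K) : Type _ :=
  RingQuot (Rel ε)

/-- The generators `Q₀ = H, Q₁, Q₂, Q₃` of `𝒰(A1_ε)`. -/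
noncomputable def Q {K : Type*} [Field K] (ε : K) (a : Fin 4) : U ε :=
  RingQuot.mkAlgHom K (Rel ε) (FreeAlgebra.ι K a)

/-- The Casimir element `c = ∑ C^{ab} Q_a Q_b`. -/
noncomputable def casimir {K : Type*} [Field K] (ε : K) : U ε :=
  ∑ a, ∑ b, C ε a b • (Q ε a * Q ε b)

/-- The element `y = c - H²`. -/
noncomputable def y {K : Type*} [Field K] (ε : K) : U ε :=
  casimir ε - Q ε 0 ^ 2

end A1

/-! ### Chord diagrams

The points of the oriented circle that carry the endpoints of chords are labelled by natural
numbers, increasing along the orientation. The chord with endpoints `p < q` is the pair `(p, q)`. -/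

namespace Chord

/-- `D` is a chord diagram: each chord is written with its smaller endpoint first, and distinct
chords have no endpoint in common. -/
def IsDiagram (D : Finset (ℕ × ℕ)) : Prop :=
  (∀ x ∈ D, x.1 < x.2) ∧
    ∀ x ∈ D, ∀ x' ∈ D, x ≠ x' → x.1 ≠ x'.1 ∧ x.1 ≠ x'.2 ∧ x.2 ≠ x'.1 ∧ x.2 ≠ x'.2

/-- The set of all endpoints of chords. -/
def endpoints (D : Finset (ℕ × ℕ)) : Finset ℕ :=
  D.image Prod.fst ∪ D.image Prod.snd

/-- Two chords intersect: their endpoints alternate on the circle. -/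
def Crosses (x x' : ℕ × ℕ) : Prop :=
  (x.1 < x'.1 ∧ x'.1 < x.2 ∧ x.2 < x'.2) ∨ (x'.1 < x.1 ∧ x.1 < x'.2 ∧ x'.2 < x.2)

instance (x x' : ℕ × ℕ) : Decidable (Crosses x x') := by
  unfold Crosses; infer_instance

/-- The endpoints of the diagram in the order in which they are met when the circle is cut
immediately before the position `t` and run through along its orientation. -/
def cutOpen (t : ℕ) (D : Finset (ℕ × ℕ)) : List ℕ :=
  ((endpoints D).filter (t ≤ ·)).sort (· ≤ ·) ++ ((endpoints D).filter (· < t)).sort (· ≤ ·)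

/-- A labelling of the endpoints by basis elements, extended by `0` to all positions. -/
def extend {D : Finset (ℕ × ℕ)} (l : endpoints D → Fin 4) (p : ℕ) : Fin 4 :=
  if h : p ∈ endpoints D then l ⟨p, h⟩ else 0

/-- The element of `𝒰(A1_ε)` assigned to the chord diagram `D` cut open at `t`. The sum runs over
all labellings of the endpoints by basis elements. Each chord contributes the entry of `C` at its
two labels, each pair of intersecting chords contributes the commuting factor (the coefficient of
`S`; the two labels of a chord have equal degrees whenever the entry of `C` is nonzero, so it does
not matter which end is used), and the basis elements are multiplied along the line. -/
noncomputable def weightCut {K : Type*} [Field K] (ε : K) (t : ℕ) (D : Finset (ℕ × ℕ)) : A1.U ε :=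
  ∑ l : endpoints D → Fin 4,
    ((∏ x ∈ D, A1.C ε (extend l x.1) (extend l x.2)) *
      ∏ p ∈ (D ×ˢ D).filter (fun p => p.1.1 < p.2.1 ∧ Crosses p.1 p.2),
        A1.phase K (extend l p.1.2) (extend l p.2.1)) •
      ((cutOpen t D).map fun p => A1.Q ε (extend l p)).prod

/-- Formal linear combinations of diagrams. -/
abbrev Comb (K : Type*) [Field K] : Type _ :=
  Finset (ℕ × ℕ) →₀ K

/-- A diagram as a formal linear combination. -/
noncomputable abbrev diag (K : Type*) [Field K] (D : Finset (ℕ × ℕ)) : Comb K :=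
  Finsupp.single D 1

/-- The universal weight system `w` for framed knots, extended linearly; the diagram `D` is cut
open at the position `cut D`. -/
noncomputable def weight {K : Type*} [Field K] (ε : K) (cut : Finset (ℕ × ℕ) → ℕ) :
    Comb K →ₗ[K] A1.U ε :=
  Finsupp.linearCombination K fun D => weightCut ε (cut D) D

/-- The linear map `s(D) = ∑_a (D - a)`. -/
noncomputable def s (K : Type*) [Field K] : Comb K →ₗ[K] Comb K :=
  Finsupp.linearCombination K fun D => ∑ a ∈ D, diag K (D.erase a)

/-- The connected sum of `D` with the diagram that has a single chord: an isolated chord is put on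
the circle after all endpoints of `D`. -/
def addIsolated (D : Finset (ℕ × ℕ)) : Finset (ℕ × ℕ) :=
  insert ((endpoints D).sup id + 1, (endpoints D).sup id + 2) D

/-- The linear map `θ`, the connected sum with the diagram that has a single chord. -/
noncomputable def θ (K : Type*) [Field K] : Comb K →ₗ[K] Comb K :=
  Finsupp.linearCombination K fun D => diag K (addIsolated D)

/-- The deframing operator `φ`, equal to `∑_{m=0}^n ((-1)^m / m!) θ^m ∘ s^m` on diagrams with `n`
chords. -/
noncomputable def φ (K : Type*) [Field K] : Comb K →ₗ[K] Comb K :=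
  Finsupp.linearCombination K fun D =>
    ∑ m ∈ Finset.range (D.card + 1),
      ((-1) ^ m / (m.factorial : K)) • ((θ K) ^ m) (((s K) ^ m) (diag K D))

/-- The deframed (unframed) universal weight system `w̄ = w ∘ φ`. -/
noncomputable def weightBar {K : Type*} [Field K] (ε : K) (cut : Finset (ℕ × ℕ) → ℕ) :
    Comb K →ₗ[K] A1.U ε :=
  weight ε cut ∘ₗ φ K

/-- The chord that connects the positions `u` and `v`. -/
def join (u v : ℕ) : ℕ × ℕ :=
  (min u v, max u v)

/-- When the chord `a` is drawn vertically, its two sides are the two arcs into which it divides the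
circle; the arc between `a.1` and `a.2` is taken as the left one (turning the picture by half a turn
exchanges the sides). This is the left end of a chord `b` that intersects `a`. -/
def leftEnd (a b : ℕ × ℕ) : ℕ :=
  if a.1 < b.1 ∧ b.1 < a.2 then b.1 else b.2

/-- The right end of a chord `b` that intersects `a`. -/
def rightEnd (a b : ℕ × ℕ) : ℕ :=
  if a.1 < b.1 ∧ b.1 < a.2 then b.2 else b.1

/-- `D - a - b - b'`. -/
def erase₃ (D : Finset (ℕ × ℕ)) (a b b' : ℕ × ℕ) : Finset (ℕ × ℕ) :=
  ((D.erase a).erase b).erase b'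

/-- `D^∥`: the left ends of `b, b'` are joined, and so are their right ends. -/
def parallel (D : Finset (ℕ × ℕ)) (a b b' : ℕ × ℕ) : Finset (ℕ × ℕ) :=
  insert (join (leftEnd a b) (leftEnd a b'))
    (insert (join (rightEnd a b) (rightEnd a b')) (erase₃ D a b b'))

/-- `D^×`: the left end of each of `b, b'` is joined to the right end of the other. -/
def crossed (D : Finset (ℕ × ℕ)) (a b b' : ℕ × ℕ) : Finset (ℕ × ℕ) :=
  insert (join (leftEnd a b) (rightEnd a b'))
    (insert (join (rightEnd a b) (leftEnd a b')) (erase₃ D a b b'))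

/-- `Γ = D^∥ - D^×`. -/
noncomputable def Γ (K : Type*) [Field K] (D : Finset (ℕ × ℕ)) (a b b' : ℕ × ℕ) : Comb K :=
  diag K (parallel D a b b') - diag K (crossed D a b b')

/-- `Λ = D^{ℓr} + D^{rℓ} - D^{ℓℓ} - D^{rr}`; the superscripts say which ends of `b` and `b'` are
connected by the one chord that is added to `D - a - b - b'`. -/
noncomputable def Λ (K : Type*) [Field K] (D : Finset (ℕ × ℕ)) (a b b' : ℕ × ℕ) : Comb K :=
  diag K (insert (join (leftEnd a b) (rightEnd a b')) (erase₃ D a b b')) +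
    diag K (insert (join (rightEnd a b) (leftEnd a b')) (erase₃ D a b b')) -
    diag K (insert (join (leftEnd a b) (leftEnd a b')) (erase₃ D a b b')) -
    diag K (insert (join (rightEnd a b) (rightEnd a b')) (erase₃ D a b b'))

end Chord

/-! ### Tensors on labelled positions and their evaluation along a word

A tensor is a function of the labellings `ℕ → Fin 4` of all positions. The label `0` stands for an
empty position, the labels `1, 2, 3` for a basis of `so(3)`. -/

namespace ChordTensor

open Function

/-- The structure constants of `so(3)`, extended by zero to the label `0`. -/
def structConst : Fin 4 → Fin 4 → Fin 4 → ℤ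
  | 1, 2, 3 => 1
  | 2, 3, 1 => 1
  | 3, 1, 2 => 1
  | 2, 1, 3 => -1
  | 3, 2, 1 => -1
  | 1, 3, 2 => -1
  | _, _, _ => 0

theorem structConst_swap (i u v : Fin 4) : structConst i u v = -structConst i v u := by
  revert i u v; decide

theorem structConst_zero_mid (i v : Fin 4) : structConst i 0 v = 0 := by
  revert i v; decide

theorem structConst_outer (i v : Fin 4) : structConst i v i = 0 := by
  revert i v; decide

section Operators

variable {R A M N : Type*} [CommRing R] [Ring A] [Algebra R A]
  [AddCommGroup M] [Module R M] [AddCommGroup N] [Module R N]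

/-- The action of the generator `i` on the tensor slot at `p`. -/
def act (R : Type*) {M : Type*} [CommRing R] [AddCommGroup M] [Module R M] (i : Fin 4) (p : ℕ) :
    Module.End R ((ℕ → Fin 4) → M) where
  toFun F l := ∑ u, structConst i u (l p) • F (update l p u)
  map_add' F G := by ext l; simp [Finset.sum_add_distrib]
  map_smul' r F := by ext l; simp [Finset.smul_sum, smul_comm r]

theorem act_apply (i : Fin 4) (p : ℕ) (F : (ℕ → Fin 4) → M) (l : ℕ → Fin 4) :
    act R i p F l = ∑ u, structConst i u (l p) • F (update l p u) := rfl

/-- Sum over the labels of `p`, with the generator at that label multiplied from the left. -/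
def step (R : Type*) {A : Type*} [CommRing R] [Ring A] [Algebra R A] (X : Fin 4 → A) (p : ℕ) :
    Module.End R ((ℕ → Fin 4) → A) where
  toFun F l := ∑ u, X u * F (update l p u)
  map_add' F G := by ext l; simp [Finset.sum_add_distrib, mul_add]
  map_smul' r F := by ext l; simp [Finset.smul_sum]

theorem step_apply (X : Fin 4 → A) (p : ℕ) (F : (ℕ → Fin 4) → A) (l : ℕ → Fin 4) :
    step R X p F l = ∑ u, X u * F (update l p u) := rfl

/-- Pointwise left multiplication. -/
def lmul (R : Type*) {A : Type*} [CommRing R] [Ring A] [Algebra R A] (x : A) :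
    Module.End R ((ℕ → Fin 4) → A) where
  toFun F l := x * F l
  map_add' F G := by ext l; simp [mul_add]
  map_smul' r F := by ext l; simp

theorem lmul_apply (x : A) (F : (ℕ → Fin 4) → A) (l : ℕ → Fin 4) :
    lmul R x F l = x * F l := rfl

/-- Composition with a linear map of the coefficients. -/
theorem act_comp (g : M →ₗ[R] N) (i : Fin 4) (p : ℕ) (F : (ℕ → Fin 4) → M) :
    act R i p (fun l => g (F l)) = fun l => g (act R i p F l) := by
  ext l
  simp [act_apply]

theorem commute_act_act {i j : Fin 4} {p q : ℕ} (h : p ≠ q) :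
    Commute (act R (M := M) i p) (act R j q) := by
  refine LinearMap.ext fun F => funext fun l => ?_
  simp only [Module.End.mul_apply, act_apply, update_of_ne h, update_of_ne h.symm,
    Finset.smul_sum]
  rw [Finset.sum_comm]
  refine Finset.sum_congr rfl fun u _ => Finset.sum_congr rfl fun v _ => ?_
  rw [smul_comm, update_comm h]

theorem commute_act_act_same (i : Fin 4) (p q : ℕ) :
    Commute (act R (M := M) i p) (act R i q) := by
  by_cases h : p = q
  · subst h; exact Commute.refl _
  · exact commute_act_act h

theorem commute_lmul_act (x : A) (i : Fin 4) (p : ℕ) : Commute (lmul R x) (act R i p) := by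
  refine LinearMap.ext fun F => funext fun l => ?_
  simp only [Module.End.mul_apply, act_apply, lmul_apply, Finset.mul_sum, mul_smul_comm]

theorem commute_step_act (X : Fin 4 → A) (i : Fin 4) {p q : ℕ} (h : p ≠ q) :
    Commute (step R X p) (act R i q) := by
  refine LinearMap.ext fun F => funext fun l => ?_
  simp only [Module.End.mul_apply, act_apply, step_apply, update_of_ne h.symm,
    Finset.smul_sum, Finset.mul_sum]
  rw [Finset.sum_comm]
  refine Finset.sum_congr rfl fun u _ => Finset.sum_congr rfl fun v _ => ?_
  rw [mul_smul_comm, update_comm h]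

/-- The commutation relations of `so(3)`. -/
def IsRep (X : Fin 4 → A) : Prop :=
  ∀ i j, X i * X j = X j * X i + ∑ u, structConst i j u • X u

theorem lmul_mul_step {X : Fin 4 → A} (hX : IsRep X) (i : Fin 4) (p : ℕ) :
    lmul R (X i) * step R X p = step R X p * lmul R (X i) + step R X p * act R i p := by
  refine LinearMap.ext fun F => funext fun l => ?_
  simp only [Module.End.mul_apply, LinearMap.add_apply, Pi.add_apply, act_apply, step_apply,
    lmul_apply, Finset.mul_sum, ← mul_assoc, hX i, add_mul, Finset.sum_add_distrib,
    update_self, update_idem, Finset.sum_mul]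
  congr 1
  rw [Finset.sum_comm]
  refine Finset.sum_congr rfl fun u _ => Finset.sum_congr rfl fun v _ => ?_
  rw [smul_mul_assoc, mul_smul_comm]

/-- Sum over the labels of the positions in a list, with the generators multiplied along it. -/
def word (R : Type*) {A : Type*} [CommRing R] [Ring A] [Algebra R A] (X : Fin 4 → A)
    (P : List ℕ) : Module.End R ((ℕ → Fin 4) → A) :=
  (P.map (step R X)).prod

theorem word_nil (X : Fin 4 → A) : word R X [] = 1 := rfl

theorem word_cons (X : Fin 4 → A) (p : ℕ) (P : List ℕ) :
    word R X (p :: P) = step R X p * word R X P := by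
  simp [word]

theorem word_append (X : Fin 4 → A) (P P' : List ℕ) :
    word R X (P ++ P') = word R X P * word R X P' := by
  simp [word]

theorem commute_word_of_commute_step {X : Fin 4 → A} {T : Module.End R ((ℕ → Fin 4) → A)}
    {P : List ℕ} (h : ∀ p ∈ P, Commute (step R X p) T) : Commute (word R X P) T := by
  induction P with
  | nil => exact Commute.one_left _
  | cons p P ih =>
    rw [word_cons]
    exact (h p (by simp)).mul_left (ih fun q hq => h q (by simp [hq]))

theorem commute_word_act (X : Fin 4 → A) (i : Fin 4) {P : List ℕ} {q : ℕ} (h : q ∉ P) :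
    Commute (word R X P) (act R i q) :=
  commute_word_of_commute_step fun _ hp =>
    commute_step_act X i fun hpq => h (hpq ▸ hp)

/-- The total action of a generator on the slots in a finite set. -/
def actSum (R : Type*) {M : Type*} [CommRing R] [AddCommGroup M] [Module R M] (i : Fin 4)
    (S : Finset ℕ) : Module.End R ((ℕ → Fin 4) → M) :=
  ∑ p ∈ S, act R i p

theorem lmul_mul_word {X : Fin 4 → A} (hX : IsRep X) (i : Fin 4) {P : List ℕ} (hP : P.Nodup) :
    lmul R (X i) * word R X P =
      word R X P * lmul R (X i) + word R X P * actSum R i P.toFinset := by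
  induction P with
  | nil => simp [word_nil, actSum]
  | cons p P ih =>
    obtain ⟨hp, hP⟩ := List.nodup_cons.1 hP
    have hsum : actSum R (M := A) i (p :: P).toFinset = act R i p + actSum R i P.toFinset := by
      rw [actSum, List.toFinset_cons, Finset.sum_insert (by simpa using hp), actSum]
    rw [hsum, word_cons, ← mul_assoc, lmul_mul_step hX, add_mul, mul_assoc (step R X p), ih hP,
      mul_assoc _ (act R i p), ← (commute_word_act X i hp).eq]
    noncomm_ring

theorem commute_lmul_actSum (x : A) (i : Fin 4) (S : Finset ℕ) :
    Commute (lmul R x) (actSum R i S) :=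
  Commute.sum_right _ _ _ fun p _ => commute_lmul_act x i p

theorem commute_word_actSum (X : Fin 4 → A) (i : Fin 4) {P : List ℕ} {S : Finset ℕ}
    (h : ∀ q ∈ S, q ∉ P) : Commute (word R X P) (actSum R i S) :=
  Commute.sum_right _ _ _ fun q hq => commute_word_act X i (h q hq)

/-- Twice the conjugation sum of a word, expressed by the squared action on its slots. -/
theorem two_mul_conj_word {X : Fin 4 → A} (hX : IsRep X) (i : Fin 4) {P : List ℕ}
    (hP : P.Nodup) :
    2 * (lmul R (X i) * word R X P * lmul R (X i)) =
      lmul R (X i * X i) * word R X P + word R X P * lmul R (X i * X i) -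
        word R X P * actSum R i P.toFinset * actSum R i P.toFinset := by
  have h := lmul_mul_word (R := R) hX i hP
  have hc := (commute_lmul_actSum (R := R) (X i) i P.toFinset).eq
  have hsq : lmul R (X i * X i) = lmul R (X i) * lmul R (X i) :=
    LinearMap.ext fun F => funext fun l => mul_assoc _ _ _
  rw [hsq]
  generalize lmul R (X i) = x at *
  generalize word R X P = w at *
  generalize actSum R (M := A) i P.toFinset = S at *
  have h1 : x * x * w = x * w * x + (w * x + w * S) * S := by
    rw [mul_assoc, h, mul_add, ← mul_assoc x w S, h, ← mul_assoc, h]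
  have h2 : w * (x * x) = x * w * x - w * x * S := by
    rw [h, add_mul, mul_assoc w S x, ← hc]
    noncomm_ring
  rw [h1, h2]
  noncomm_ring

end Operators

end ChordTensor

namespace ChordTensor

open Function

section Operators

variable {R A M : Type*} [CommRing R] [Ring A] [Algebra R A] [AddCommGroup M] [Module R M]

/-- Substitution of the label `u` at the position `p`. -/
def subst (R : Type*) {M : Type*} [CommRing R] [AddCommGroup M] [Module R M] (p : ℕ) (u : Fin 4) :
    Module.End R ((ℕ → Fin 4) → M) where
  toFun F l := F (update l p u)
  map_add' _ _ := rfl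
  map_smul' _ _ := rfl

theorem subst_apply (p : ℕ) (u : Fin 4) (F : (ℕ → Fin 4) → M) (l : ℕ → Fin 4) :
    subst R p u F l = F (update l p u) := rfl

theorem step_eq_sum (X : Fin 4 → A) (p : ℕ) :
    step R X p = ∑ u, lmul R (X u) * subst R p u := by
  refine LinearMap.ext fun F => funext fun l => ?_
  simp [step_apply, lmul_apply, subst_apply, LinearMap.sum_apply]

theorem commute_lmul_subst (x : A) (p : ℕ) (u : Fin 4) : Commute (lmul R x) (subst R p u) := rfl

theorem commute_word_subst (X : Fin 4 → A) {P : List ℕ} {q : ℕ} (h : q ∉ P) (u : Fin 4) :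
    Commute (word R X P) (subst R q u) := by
  refine commute_word_of_commute_step fun p hp => ?_
  have hpq : p ≠ q := fun hpq => h (hpq ▸ hp)
  refine LinearMap.ext fun F => funext fun l => ?_
  simp only [Module.End.mul_apply, step_apply, subst_apply, update_comm hpq]

theorem commute_subst_act {p q : ℕ} (h : p ≠ q) (u i : Fin 4) :
    Commute (subst R (M := M) p u) (act R i q) := by
  refine LinearMap.ext fun F => funext fun l => ?_
  simp only [Module.End.mul_apply, act_apply, subst_apply, update_of_ne h.symm, update_comm h]

theorem subst_mul_act_self (p : ℕ) (u : Fin 4) : subst R (M := M) p u * act R u p = 0 := by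
  refine LinearMap.ext fun F => funext fun l => ?_
  simp [act_apply, subst_apply, structConst_outer]

/-- A position where the total action vanishes can be moved from the start of a word to its end. -/
theorem word_rotate_one {X : Fin 4 → A} (hX : IsRep X) {p : ℕ} {P : List ℕ}
    (hP : (p :: P).Nodup) {F : (ℕ → Fin 4) → A}
    (hF : ∀ i, actSum R i (p :: P).toFinset F = 0) :
    word R X (p :: P) F = word R X (P ++ [p]) F := by
  obtain ⟨hp, hP⟩ := List.nodup_cons.1 hP
  have key : ∀ u, (word R X P * lmul R (X u)) * subst R p u =
      lmul R (X u) * subst R p u * word R X P - word R X P * actSum R u P.toFinset * subst R p u := by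
    intro u
    rw [mul_assoc (lmul R (X u)), ← (commute_word_subst X hp u).eq, ← mul_assoc (lmul R (X u)),
      lmul_mul_word hX u hP]
    noncomm_ring
  have hz : ∀ u, actSum R u P.toFinset (subst R p u F) = 0 := by
    intro u
    have hc : Commute (subst R (M := A) p u) (actSum R u P.toFinset) :=
      Commute.sum_right _ _ _ fun q hq => commute_subst_act (by
        rintro rfl; exact hp (by simpa using hq)) u u
    have h := hF u
    rw [actSum, List.toFinset_cons, Finset.sum_insert (by simpa using hp), LinearMap.add_apply] at h
    have h2 := congrArg (subst R p u) h
    rw [map_add, ← Module.End.mul_apply, subst_mul_act_self, LinearMap.zero_apply, zero_add,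
      map_zero] at h2
    rw [← Module.End.mul_apply, ← hc.eq, Module.End.mul_apply]
    exact h2
  rw [word_append, word_cons, word_cons, word_nil, mul_one, step_eq_sum, Finset.mul_sum,
    Finset.sum_mul, LinearMap.sum_apply, LinearMap.sum_apply]
  refine Finset.sum_congr rfl fun u _ => ?_
  rw [← mul_assoc, key, LinearMap.sub_apply, mul_assoc (word R X P), Module.End.mul_apply
    (word R X P), Module.End.mul_apply (actSum R u _), hz, map_zero, sub_zero]

theorem word_rotate {X : Fin 4 → A} (hX : IsRep X) (P P' : List ℕ)
    (hP : (P ++ P').Nodup) {F : (ℕ → Fin 4) → A}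
    (hF : ∀ i, actSum R i (P ++ P').toFinset F = 0) :
    word R X (P ++ P') F = word R X (P' ++ P) F := by
  induction P generalizing P' with
  | nil => simp
  | cons p P ih =>
    rw [List.cons_append] at hP hF ⊢
    rw [word_rotate_one hX hP hF, List.append_assoc, ih (P' ++ [p]), List.append_assoc, List.singleton_append]
    · rw [← List.append_assoc]
      exact (List.perm_append_singleton p (P ++ P')).symm.nodup hP
    · intro i
      rw [← List.append_assoc,
        List.toFinset_eq_of_perm _ _ (List.perm_append_singleton p (P ++ P'))]
      exact hF i

/-- Restriction of a tensor to the label `0` at the position `p`. -/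
def pin (p : ℕ) (F : (ℕ → Fin 4) → M) : (ℕ → Fin 4) → M :=
  fun l => if l p = 0 then F l else 0

theorem word_pin_eq_zero (X : Fin 4 → A) {P : List ℕ} {p : ℕ} (hp : p ∉ P)
    (F : (ℕ → Fin 4) → A) {l : ℕ → Fin 4} (hl : l p ≠ 0) : word R X P (pin p F) l = 0 := by
  induction P generalizing l with
  | nil => simp [word_nil, pin, hl]
  | cons q P ih =>
    simp only [List.mem_cons, not_or] at hp
    rw [word_cons, Module.End.mul_apply, step_apply]
    refine Finset.sum_eq_zero fun u _ => ?_
    rw [ih hp.2 (by rwa [update_of_ne hp.1]), mul_zero]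

/-- Slots that are restricted to the label `0` can be left out. -/
theorem word_pin {X : Fin 4 → A} (hX : X 0 = 1) {P : List ℕ} (hP : P.Nodup) (p : ℕ)
    (F : (ℕ → Fin 4) → A) {l : ℕ → Fin 4} (hl : l p = 0) :
    word R X P (pin p F) l = word R X (P.filter (· ≠ p)) F l := by
  induction P generalizing l with
  | nil => simp [word_nil, pin, hl]
  | cons q P ih =>
    obtain ⟨hq, hP⟩ := List.nodup_cons.1 hP
    by_cases h : q = p
    · subst h
      rw [List.filter_cons_of_neg (by simp), word_cons, Module.End.mul_apply, step_apply,
        Finset.sum_eq_single 0]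
      · rw [← hl, update_eq_self, hl, hX, one_mul, ih hP hl]
      · intro u _ hu
        rw [word_pin_eq_zero X hq F (by simpa using hu), mul_zero]
      · simp
    · rw [List.filter_cons_of_pos (by simpa using h), word_cons, word_cons, Module.End.mul_apply,
        Module.End.mul_apply, step_apply, step_apply]
      refine Finset.sum_congr rfl fun u _ => ?_
      rw [ih hP (by rwa [update_of_ne (Ne.symm h)])]

end Operators

/-! ### The tensors of chord diagrams -/

section Chords

variable {R A : Type*} [CommRing R] [Ring A] [Algebra R A]

/-- The form `diag(z, κ, κ, κ)`. -/
def metric (κ z : R) (u v : Fin 4) : R :=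
  if u = v then (if u = 0 then z else κ) else 0

theorem metric_symm (κ z : R) (u v : Fin 4) : metric κ z u v = metric κ z v u := by
  unfold metric
  by_cases h : u = v
  · subst h; rfl
  · rw [if_neg h, if_neg (Ne.symm h)]

theorem metric_add (κ z w : R) (u v : Fin 4) :
    metric κ (z + w) u v = metric κ z u v + w * metric 0 1 u v := by
  unfold metric
  split_ifs <;> simp

/-- The tensor of a chord diagram: every chord contributes the entry of the form. -/
def chordTensor (κ z : R) (D : Finset (ℕ × ℕ)) (l : ℕ → Fin 4) : R :=
  ∏ x ∈ D, metric κ z (l x.1) (l x.2)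

/-- The evaluation of a tensor along a word. -/
def eval (R : Type*) {A : Type*} [CommRing R] [Ring A] [Algebra R A] (X : Fin 4 → A)
    (P : List ℕ) : ((ℕ → Fin 4) → R) →ₗ[R] A where
  toFun F := word R X P (fun l => algebraMap R A (F l)) 0
  map_add' F G := by
    have : (fun l => algebraMap R A ((F + G) l)) =
      (fun l => algebraMap R A (F l)) + fun l => algebraMap R A (G l) := by ext l; simp
    rw [this, map_add, Pi.add_apply]
  map_smul' r F := by
    have : (fun l => algebraMap R A ((r • F) l)) = r • (fun l => algebraMap R A (F l)) := by
      ext l; simp [Algebra.smul_def]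
    rw [this, map_smul, Pi.smul_apply, RingHom.id_apply]

theorem eval_apply (X : Fin 4 → A) (P : List ℕ) (F : (ℕ → Fin 4) → R) :
    eval R X P F = word R X P (fun l => algebraMap R A (F l)) 0 := rfl

theorem act_algebraMap (i : Fin 4) (p : ℕ) (F : (ℕ → Fin 4) → R) :
    act R i p (fun l => algebraMap R A (F l)) = fun l => algebraMap R A (act R i p F l) :=
  act_comp (Algebra.linearMap R A) i p F

theorem actSum_algebraMap (i : Fin 4) (S : Finset ℕ) (F : (ℕ → Fin 4) → R) :
    actSum R i S (fun l => algebraMap R A (F l)) = fun l => algebraMap R A (actSum R i S F l) := by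
  ext l
  simp [actSum, LinearMap.sum_apply, act_algebraMap]

theorem eval_rotate {X : Fin 4 → A} (hX : IsRep X) (P P' : List ℕ)
    (hP : (P ++ P').Nodup) {F : (ℕ → Fin 4) → R}
    (hF : ∀ i, actSum R i (P ++ P').toFinset F = 0) :
    eval R X (P ++ P') F = eval R X (P' ++ P) F := by
  rw [eval_apply, eval_apply, word_rotate hX P P' hP]
  intro i
  rw [actSum_algebraMap, hF]
  ext l
  simp

theorem chordTensor_insert (κ z : R) {D : Finset (ℕ × ℕ)} {x : ℕ × ℕ} (hx : x ∉ D)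
    (l : ℕ → Fin 4) :
    chordTensor κ z (insert x D) l = metric κ z (l x.1) (l x.2) * chordTensor κ z D l :=
  Finset.prod_insert hx

/-- Chords whose ends are restricted to the label `0` can be left out. -/
theorem eval_chordTensor_zero_one_mul {X : Fin 4 → A} (hX : X 0 = 1) {P : List ℕ} (hP : P.Nodup)
    (T : Finset (ℕ × ℕ)) (F : (ℕ → Fin 4) → R) :
    eval R X P (fun l => chordTensor 0 1 T l * F l) =
      eval R X (P.filter (· ∉ Chord.endpoints T)) F := by
  induction T using Finset.induction_on generalizing P with
  | empty => simp [chordTensor, Chord.endpoints]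
  | insert x T hx ih =>
    have h : (fun l => algebraMap R A (chordTensor 0 1 (insert x T) l * F l)) =
        pin x.1 (pin x.2 (fun l => algebraMap R A (chordTensor 0 1 T l * F l))) := by
      ext l
      rw [chordTensor_insert _ _ hx]
      by_cases h1 : l x.1 = 0 <;> by_cases h2 : l x.2 = 0 <;>
        simp [pin, metric, h1, h2, eq_comm (a := (0 : Fin 4))]
    rw [eval_apply, h, word_pin hX hP _ _ rfl, word_pin hX (hP.filter _) _ _ rfl, ← eval_apply,
      ih ((hP.filter _).filter _), List.filter_filter, List.filter_filter]
    refine congrArg (fun P => eval R X P F) (List.filter_congr fun p _ => ?_)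
    simp only [Chord.endpoints, Finset.image_insert, Finset.mem_union, Finset.mem_insert,
      Bool.and_eq_decide, decide_eq_decide, decide_eq_true_eq, ne_eq]
    tauto

/-- The conjugation formula for a chord that separates two words. -/
theorem two_mul_eval_chord {X : Fin 4 → A} (hX : IsRep X) (h0 : X 0 = 1) {κ z y : R}
    (hy : κ • (X 1 * X 1 + X 2 * X 2 + X 3 * X 3) = algebraMap R A y)
    {p q : ℕ} {L L' : List ℕ} (hP : (p :: (L ++ q :: L')).Nodup) {F : (ℕ → Fin 4) → R}
    (hp : ∀ l u, F (update l p u) = F l) (hq : ∀ l u, F (update l q u) = F l) :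
    2 * eval R X (p :: (L ++ q :: L')) (fun l => metric κ z (l p) (l q) * F l) =
      (2 * (z + y)) • eval R X (L ++ L') F -
        κ • ∑ i, eval R X (L ++ L') (actSum R i L.toFinset (actSum R i L.toFinset F)) := by
  simp only [List.nodup_cons, List.nodup_append, List.mem_append, List.mem_cons, not_or] at hP
  obtain ⟨⟨hpL, hpq, hpL'⟩, hL, ⟨hqL', hL'⟩, hLL'⟩ := hP
  have hqL : q ∉ L := fun h => hLL' q h q (Or.inl rfl) rfl
  have hdisj : ∀ i, Commute (word R X L') (actSum R i L.toFinset) := fun i =>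
    commute_word_actSum X i fun r hr hr' => hLL' r (by simpa using hr) r (Or.inr hr') rfl
  set F' : (ℕ → Fin 4) → A := fun l => algebraMap R A (F l) with hF'
  have hword : word R X (p :: (L ++ q :: L'))
      (fun l => algebraMap R A (metric κ z (l p) (l q) * F l)) =
      ∑ u, metric κ z u u • (lmul R (X u) * word R X L * lmul R (X u)) (word R X L' F') := by
    have hsub : ∀ u v, subst R p u (subst R q v
        (fun l => algebraMap R A (metric κ z (l p) (l q) * F l))) = metric κ z u v • F' := by
      intro u v
      ext l
      simp only [subst_apply, update_self, update_of_ne hpq, hp, hq, hF', map_mul, Pi.smul_apply,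
        Algebra.smul_def]
    have hops : word R X (p :: (L ++ q :: L')) = ∑ u, ∑ v,
        (lmul R (X u) * word R X L * lmul R (X v)) * word R X L' * (subst R p u * subst R q v) := by
      rw [word_cons, word_append, word_cons, step_eq_sum, step_eq_sum, Finset.sum_mul]
      refine Finset.sum_congr rfl fun u _ => ?_
      rw [Finset.sum_mul, Finset.mul_sum, Finset.mul_sum]
      refine Finset.sum_congr rfl fun v _ => ?_
      have c1 := (commute_word_subst (R := R) X hpL u).eq
      have c2 := (commute_word_subst (R := R) X hqL' v).eq
      have c3 := (commute_word_subst (R := R) X hpL' u).eq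
      have c4 := (commute_lmul_subst (R := R) (X v) p u).eq
      have c5 : subst R (M := A) q v * subst R p u = subst R p u * subst R q v := by
        refine LinearMap.ext fun F => funext fun l => ?_
        simp only [Module.End.mul_apply, subst_apply, update_comm hpq]
      generalize subst R (M := A) p u = a at *
      generalize subst R (M := A) q v = b at *
      generalize word R X L = w at *
      generalize word R X L' = w' at *
      generalize lmul R (X v) = x at *
      rw [mul_assoc (lmul R (X u)) a, ← mul_assoc a w, ← c1, mul_assoc w a, ← mul_assoc a,
        ← mul_assoc a x b, ← c4, mul_assoc (x * a) b w', ← c2, mul_assoc x a,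
        ← mul_assoc a w' b, ← c3]
      simp only [mul_assoc]
    rw [hops, LinearMap.sum_apply]
    refine Finset.sum_congr rfl fun u _ => ?_
    rw [LinearMap.sum_apply, Finset.sum_eq_single u]
    · rw [Module.End.mul_apply, Module.End.mul_apply, Module.End.mul_apply (subst R p u), hsub,
        map_smul, map_smul]
    · intro v _ hv
      rw [Module.End.mul_apply, Module.End.mul_apply, Module.End.mul_apply (subst R p u), hsub,
        map_smul]
      simp [metric, Ne.symm hv]
    · simp
  have hconj : ∀ i, 2 * ((lmul R (X i) * word R X L * lmul R (X i)) (word R X L' F')) 0 =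
      (X i * X i) * eval R X (L ++ L') F + (word R X L (lmul R (X i * X i) (word R X L' F'))) 0 -
        eval R X (L ++ L') (actSum R i L.toFinset (actSum R i L.toFinset F)) := by
    intro i
    have h := congrArg (fun T : Module.End R ((ℕ → Fin 4) → A) => T (word R X L' F') 0)
      (two_mul_conj_word (R := R) hX i hL)
    have e : word R X L (actSum R i L.toFinset (actSum R i L.toFinset (word R X L' F'))) =
        word R X (L ++ L') (fun l => algebraMap R A
          (actSum R i L.toFinset (actSum R i L.toFinset F) l)) := by
      rw [← actSum_algebraMap, ← actSum_algebraMap, word_append, ← hF', Module.End.mul_apply,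
        ← Module.End.mul_apply (word R X L'), (hdisj i).eq, Module.End.mul_apply (actSum R i _),
        ← Module.End.mul_apply (word R X L'), (hdisj i).eq, Module.End.mul_apply (actSum R i _)]
    have e2 : (2 : Module.End R ((ℕ → Fin 4) → A)) = 1 + 1 := one_add_one_eq_two.symm
    simp only [e2, LinearMap.sub_apply, LinearMap.add_apply, Pi.sub_apply, Pi.add_apply,
      Module.End.mul_apply, e, Module.End.one_apply, lmul_apply] at h
    rw [two_mul, eval_apply, eval_apply, ← hF']
    simp only [Module.End.mul_apply, lmul_apply]
    rw [h, word_append, Module.End.mul_apply]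
    rfl
  have hact0 : ∀ S : Finset ℕ, actSum R (M := R) 0 S = 0 := by
    intro S
    refine Finset.sum_eq_zero fun p _ => LinearMap.ext fun F => funext fun l => ?_
    have : ∀ u v, structConst 0 u v = 0 := by decide
    simp [act_apply, this]
  have hyl : κ • (lmul R (X 1 * X 1) + lmul R (X 2 * X 2) + lmul R (X 3 * X 3)) =
      y • (1 : Module.End R ((ℕ → Fin 4) → A)) := by
    refine LinearMap.ext fun G => funext fun l => ?_
    simp only [LinearMap.smul_apply, LinearMap.add_apply, Pi.smul_apply, Pi.add_apply, lmul_apply,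
      ← add_mul, ← smul_mul_assoc, hy]
    rw [Module.End.one_apply, Algebra.smul_def]
  have hyr := congrArg (fun T : Module.End R ((ℕ → Fin 4) → A) =>
    word R X L (T (word R X L' F')) 0) hyl
  simp only [LinearMap.smul_apply, LinearMap.add_apply, map_smul, map_add, Pi.smul_apply,
    Pi.add_apply, Module.End.one_apply] at hyr
  have hy' := congrArg (· * eval R X (L ++ L') F) hy
  have hE : word R X L (word R X L' F') 0 = eval R X (L ++ L') F := by
    rw [eval_apply, word_append, Module.End.mul_apply]
  rw [hE] at hyr
  simp only [smul_mul_assoc, add_mul, ← Algebra.smul_def] at hy'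
  have hz : (lmul R (X 0) * word R X L * lmul R (X 0)) (word R X L' F') 0 =
      eval R X (L ++ L') F := by
    rw [← hE, h0]
    have : lmul R (1 : A) = 1 := LinearMap.ext fun F => funext fun l => one_mul _
    rw [this, one_mul, mul_one]
  rw [eval_apply, hword, Fin.sum_univ_four, Fin.sum_univ_four, hact0]
  simp only [Pi.add_apply, Pi.smul_apply, hz, mul_add, mul_smul_comm, hconj, LinearMap.zero_apply,
    map_zero]
  have m0 : metric κ z 0 0 = z := by simp [metric]
  have m1 : metric κ z 1 1 = κ := by simp [metric]
  have m2 : metric κ z 2 2 = κ := by simp [metric]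
  have m3 : metric κ z 3 3 = κ := by simp [metric]
  rw [m0, m1, m2, m3, zero_add, two_mul (eval R X (L ++ L') F)]
  linear_combination (norm := module) hyr + hy'

end Chords

end ChordTensor

/-! ### Endpoints of chord diagrams and their order along the cut circle -/

namespace Chord

theorem mem_endpoints {D : Finset (ℕ × ℕ)} {p : ℕ} :
    p ∈ endpoints D ↔ ∃ x ∈ D, p = x.1 ∨ p = x.2 := by
  simp only [endpoints, Finset.mem_union, Finset.mem_image]
  constructor
  · rintro (⟨x, hx, rfl⟩ | ⟨x, hx, rfl⟩)
    exacts [⟨x, hx, Or.inl rfl⟩, ⟨x, hx, Or.inr rfl⟩]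
  · rintro ⟨x, hx, rfl | rfl⟩
    exacts [Or.inl ⟨x, hx, rfl⟩, Or.inr ⟨x, hx, rfl⟩]

theorem fst_mem_endpoints {D : Finset (ℕ × ℕ)} {x : ℕ × ℕ} (hx : x ∈ D) : x.1 ∈ endpoints D :=
  mem_endpoints.2 ⟨x, hx, Or.inl rfl⟩

theorem snd_mem_endpoints {D : Finset (ℕ × ℕ)} {x : ℕ × ℕ} (hx : x ∈ D) : x.2 ∈ endpoints D :=
  mem_endpoints.2 ⟨x, hx, Or.inr rfl⟩

theorem mem_endpoints_insert {D : Finset (ℕ × ℕ)} {x : ℕ × ℕ} {p : ℕ} :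
    p ∈ endpoints (insert x D) ↔ p = x.1 ∨ p = x.2 ∨ p ∈ endpoints D := by
  simp only [mem_endpoints, Finset.exists_mem_insert, or_assoc]

theorem endpoints_mono {D D' : Finset (ℕ × ℕ)} (h : D' ⊆ D) : endpoints D' ⊆ endpoints D := by
  intro p hp
  obtain ⟨x, hx, h'⟩ := mem_endpoints.1 hp
  exact mem_endpoints.2 ⟨x, h hx, h'⟩

theorem IsDiagram.mono {D D' : Finset (ℕ × ℕ)} (hD : IsDiagram D) (h : D' ⊆ D) : IsDiagram D' :=
  ⟨fun x hx => hD.1 x (h hx), fun x hx x' hx' => hD.2 x (h hx) x' (h hx')⟩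

/-- A chord of a diagram has no end in common with the rest of the diagram. -/
theorem IsDiagram.notMem_endpoints {D D' : Finset (ℕ × ℕ)} (hD : IsDiagram D) (h : D' ⊆ D)
    {x : ℕ × ℕ} (hx : x ∈ D) (hx' : x ∉ D') : x.1 ∉ endpoints D' ∧ x.2 ∉ endpoints D' := by
  constructor <;>
  · intro hp
    obtain ⟨z, hz, hp⟩ := mem_endpoints.1 hp
    have := hD.2 x hx z (h hz) (by rintro rfl; exact hx' hz)
    tauto

theorem IsDiagram.endpoints_sdiff {D T : Finset (ℕ × ℕ)} (hD : IsDiagram D) (hT : T ⊆ D) {p : ℕ} :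
    p ∈ endpoints (D \ T) ↔ p ∈ endpoints D ∧ p ∉ endpoints T := by
  constructor
  · intro hp
    refine ⟨endpoints_mono Finset.sdiff_subset hp, ?_⟩
    obtain ⟨x, hx, hp⟩ := mem_endpoints.1 hp
    obtain ⟨hxD, hxT⟩ := Finset.mem_sdiff.1 hx
    have := hD.notMem_endpoints hT hxD hxT
    rcases hp with rfl | rfl
    exacts [this.1, this.2]
  · rintro ⟨hp, hpT⟩
    obtain ⟨x, hx, hp⟩ := mem_endpoints.1 hp
    refine mem_endpoints.2 ⟨x, Finset.mem_sdiff.2 ⟨hx, fun hxT => hpT ?_⟩, hp⟩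
    exact mem_endpoints.2 ⟨x, hxT, hp⟩

@[to_additive]
theorem IsDiagram.prod_endpoints {M : Type*} [CommMonoid M] {D : Finset (ℕ × ℕ)}
    (hD : IsDiagram D) (f : ℕ → M) : ∏ p ∈ endpoints D, f p = ∏ x ∈ D, f x.1 * f x.2 := by
  have h : endpoints D = D.biUnion fun x => {x.1, x.2} := by
    ext p
    simp [mem_endpoints]
  rw [h, Finset.prod_biUnion]
  · exact Finset.prod_congr rfl fun x hx => Finset.prod_pair (hD.1 x hx).ne
  · intro x hx x' hx' hne
    have := hD.2 x hx x' hx' hne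
    simp [Function.onFun, Finset.disjoint_left, this]

/-- The points of a finite set, in the order in which they are met after a cut at `t`. -/
def cutSort (t : ℕ) (E : Finset ℕ) : List ℕ :=
  (E.filter (t ≤ ·)).sort (· ≤ ·) ++ (E.filter (· < t)).sort (· ≤ ·)

theorem cutOpen_eq (t : ℕ) (D : Finset (ℕ × ℕ)) : cutOpen t D = cutSort t (endpoints D) := rfl

theorem nodup_cutSort (t : ℕ) (E : Finset ℕ) : (cutSort t E).Nodup := by
  refine List.Nodup.append (Finset.sort_nodup _ _) (Finset.sort_nodup _ _) ?_
  intro p hp hp'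
  simp only [Finset.mem_sort, Finset.mem_filter] at hp hp'
  omega

theorem toFinset_cutSort (t : ℕ) (E : Finset ℕ) : (cutSort t E).toFinset = E := by
  ext p
  simp only [cutSort, List.toFinset_append, Finset.sort_toFinset, Finset.mem_union,
    Finset.mem_filter]
  rcases le_or_gt t p with h | h
  · simp [h, h.not_gt]
  · simp [h, h.not_ge]

theorem filter_sort (E : Finset ℕ) (q : ℕ → Prop) [DecidablePred q] :
    (E.sort (· ≤ ·)).filter q = (E.filter q).sort (· ≤ ·) := by
  have h := (List.toFinset_sort (· ≤ ·) ((E.sort_nodup (· ≤ ·)).filter (fun p => decide (q p)))).2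
    ((E.pairwise_sort (· ≤ ·)).filter _)
  rw [← h]
  congr 1
  ext p
  simp

theorem filter_cutSort (t : ℕ) (E : Finset ℕ) (q : ℕ → Prop) [DecidablePred q] :
    (cutSort t E).filter q = cutSort t (E.filter q) := by
  rw [cutSort, List.filter_append, filter_sort, filter_sort, cutSort, Finset.filter_comm,
    Finset.filter_comm (· < t)]

theorem sort_union_of_lt {E E' : Finset ℕ} (h : ∀ p ∈ E, ∀ q ∈ E', p < q) :
    (E ∪ E').sort (· ≤ ·) = E.sort (· ≤ ·) ++ E'.sort (· ≤ ·) := by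
  have hn : (E.sort (· ≤ ·) ++ E'.sort (· ≤ ·)).Nodup := by
    refine List.Nodup.append (Finset.sort_nodup _ _) (Finset.sort_nodup _ _) ?_
    intro p hp hp'
    exact lt_irrefl p (h p (by simpa using hp) p (by simpa using hp'))
  have hp : (E.sort (· ≤ ·) ++ E'.sort (· ≤ ·)).Pairwise (· ≤ ·) := by
    refine List.pairwise_append.2 ⟨Finset.pairwise_sort _ _, Finset.pairwise_sort _ _, ?_⟩
    intro p hp q hq
    exact (h p (by simpa using hp) q (by simpa using hq)).le
  rw [← (List.toFinset_sort (· ≤ ·) hn).2 hp]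
  congr 1
  ext p
  simp

theorem cutSort_zero (E : Finset ℕ) : cutSort 0 E = E.sort (· ≤ ·) := by
  simp [cutSort]

theorem cutSort_zero_eq_append (t : ℕ) (E : Finset ℕ) :
    cutSort 0 E = (E.filter (· < t)).sort (· ≤ ·) ++ (E.filter (t ≤ ·)).sort (· ≤ ·) := by
  rw [cutSort_zero, ← sort_union_of_lt]
  · congr 1
    ext p
    simp only [Finset.mem_union, Finset.mem_filter]
    rcases le_or_gt t p with h | h
    · simp [h, h.not_gt]
    · simp [h, h.not_ge]
  · intro p hp q hq
    simp only [Finset.mem_filter] at hp hq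
    omega

/-- The order of the endpoints when the circle is cut at the first end of a chord `(p, q)`. -/
theorem cutSort_insert_insert {p q : ℕ} (hpq : p < q) {E : Finset ℕ} (hp : p ∉ E) (hq : q ∉ E) :
    ∃ L', cutSort p (insert p (insert q E)) =
        p :: ((E.filter fun r => p < r ∧ r < q).sort (· ≤ ·) ++ q :: L') ∧
      cutSort p E = (E.filter fun r => p < r ∧ r < q).sort (· ≤ ·) ++ L' := by
  refine ⟨(E.filter (q < ·)).sort (· ≤ ·) ++ (E.filter (· < p)).sort (· ≤ ·), ?_, ?_⟩
  · have h1 : (insert p (insert q E)).filter (p ≤ ·) =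
        {p} ∪ ((E.filter fun r => p < r ∧ r < q) ∪ ({q} ∪ E.filter (q < ·))) := by
      ext r
      have h1 : r = p → r ∉ E := by rintro rfl; exact hp
      have h2 : r = q → r ∉ E := by rintro rfl; exact hq
      simp only [Finset.mem_filter, Finset.mem_insert, Finset.mem_union, Finset.mem_singleton]
      by_cases hr : r ∈ E
      · simp only [hr, true_and, or_true]
        have h3 : r ≠ p := fun h => h1 h hr
        have h4 : r ≠ q := fun h => h2 h hr
        omega
      · simp only [hr, false_and, or_false, false_or]
        omega
    have h2 : (insert p (insert q E)).filter (· < p) = E.filter (· < p) := by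
      ext r
      simp only [Finset.mem_filter, Finset.mem_insert]
      by_cases hr : r ∈ E
      · simp [hr]
      · simp only [hr, or_false, false_and, iff_false]
        omega
    rw [cutSort, h1, h2, sort_union_of_lt, sort_union_of_lt, sort_union_of_lt,
      Finset.sort_singleton, Finset.sort_singleton]
    · simp
    all_goals
      intro r hr r' hr'
      simp only [Finset.mem_filter, Finset.mem_union, Finset.mem_singleton] at hr hr'
      omega
  · have h1 : E.filter (p ≤ ·) = (E.filter fun r => p < r ∧ r < q) ∪ E.filter (q < ·) := by
      ext r
      have h1 : r = p → r ∉ E := by rintro rfl; exact hp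
      have h2 : r = q → r ∉ E := by rintro rfl; exact hq
      simp only [Finset.mem_filter, Finset.mem_union]
      by_cases hr : r ∈ E
      · simp only [hr, true_and]
        have h3 : r ≠ p := fun h => h1 h hr
        have h4 : r ≠ q := fun h => h2 h hr
        omega
      · simp [hr]
    rw [cutSort, h1, sort_union_of_lt, List.append_assoc]
    intro r hr r' hr'
    simp only [Finset.mem_filter] at hr hr'
    omega

/-! ### Joining two points by a chord -/

theorem join_fst_snd {x : ℕ × ℕ} (hx : x.1 < x.2) : join x.1 x.2 = x := by
  simp [join, hx.le]

theorem join_comm (u v : ℕ) : join u v = join v u := by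
  simp [join, min_comm, max_comm]

theorem join_cases (u v : ℕ) : join u v = (u, v) ∨ join u v = (v, u) := by
  rcases le_total u v with h | h <;> simp [join, h]

theorem mem_endpoints_insert_join {D : Finset (ℕ × ℕ)} {u v p : ℕ} :
    p ∈ endpoints (insert (join u v) D) ↔ p = u ∨ p = v ∨ p ∈ endpoints D := by
  rw [mem_endpoints_insert]
  rcases join_cases u v with h | h <;> rw [h]
  tauto

theorem join_notMem {D : Finset (ℕ × ℕ)} {u v : ℕ} (hu : u ∉ endpoints D) : join u v ∉ D := by
  intro h
  rcases join_cases u v with h' | h' <;> rw [h'] at h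
  exacts [hu (fst_mem_endpoints h), hu (snd_mem_endpoints h)]

theorem IsDiagram.insert_join {D : Finset (ℕ × ℕ)} (hD : IsDiagram D) {u v : ℕ} (huv : u ≠ v)
    (hu : u ∉ endpoints D) (hv : v ∉ endpoints D) : IsDiagram (insert (join u v) D) := by
  have key : ∀ x ∈ D, x.1 ≠ (join u v).1 ∧ x.1 ≠ (join u v).2 ∧ x.2 ≠ (join u v).1 ∧
      x.2 ≠ (join u v).2 := by
    intro x hx
    have h1 := fst_mem_endpoints hx
    have h2 := snd_mem_endpoints hx
    rcases join_cases u v with h | h <;> rw [h] <;>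
      refine ⟨?_, ?_, ?_, ?_⟩ <;> (intro h'; simp_all)
  constructor
  · intro x hx
    rcases Finset.mem_insert.1 hx with rfl | hx
    · simp only [join]; omega
    · exact hD.1 x hx
  · intro x hx x' hx' hne
    rcases Finset.mem_insert.1 hx with rfl | hx <;> rcases Finset.mem_insert.1 hx' with rfl | hx'
    · exact absurd rfl hne
    · have := key x' hx'
      exact ⟨this.1.symm, this.2.2.1.symm, this.2.1.symm, this.2.2.2.symm⟩
    · exact key x hx
    · exact hD.2 x hx x' hx' hne

/-! ### The two ends of a chord that crosses a given one -/

theorem join_leftEnd_rightEnd (a : ℕ × ℕ) {b : ℕ × ℕ} (hb : b.1 < b.2) :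
    join (leftEnd a b) (rightEnd a b) = b := by
  unfold leftEnd rightEnd
  split_ifs
  · exact join_fst_snd hb
  · rw [join_comm]; exact join_fst_snd hb

theorem leftEnd_ne_rightEnd (a : ℕ × ℕ) {b : ℕ × ℕ} (hb : b.1 < b.2) :
    leftEnd a b ≠ rightEnd a b := by
  unfold leftEnd rightEnd
  split_ifs <;> omega

end Chord

namespace ChordTensor

open Function Chord

section Tensors

variable {R A : Type*} [CommRing R] [Ring A] [Algebra R A]

theorem sum_structConst_metric (κ z : R) (i a b : Fin 4) :
    ∑ u, structConst i u a • metric κ z u b = structConst i b a • κ := by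
  rw [Finset.sum_eq_single b]
  · by_cases hb : b = 0
    · subst hb; simp [structConst_zero_mid]
    · simp [metric, hb]
  · intro u _ hu
    simp [metric, hu]
  · simp

theorem act_metric_mul (κ z : R) (i : Fin 4) {p q : ℕ} (hpq : p ≠ q) {G : (ℕ → Fin 4) → R}
    (hG : ∀ l u, G (update l p u) = G l) :
    act R i p (fun l => metric κ z (l p) (l q) * G l) =
      fun l => (structConst i (l q) (l p) • κ) * G l := by
  ext l
  simp only [act_apply, update_self, update_of_ne hpq.symm, hG]
  rw [← sum_structConst_metric κ z, Finset.sum_mul]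
  exact Finset.sum_congr rfl fun u _ => (smul_mul_assoc _ _ _).symm

theorem act_add_act_metric_mul (κ z : R) (i : Fin 4) {p q : ℕ} (hpq : p ≠ q)
    {G : (ℕ → Fin 4) → R} (hp : ∀ l u, G (update l p u) = G l)
    (hq : ∀ l u, G (update l q u) = G l) :
    act R i p (fun l => metric κ z (l p) (l q) * G l) +
      act R i q (fun l => metric κ z (l p) (l q) * G l) = 0 := by
  have h : (fun l : ℕ → Fin 4 => metric κ z (l p) (l q) * G l) =
      fun l => metric κ z (l q) (l p) * G l := by
    ext l
    rw [metric_symm]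
  rw [act_metric_mul κ z i hpq hp, h, act_metric_mul κ z i hpq.symm hq]
  ext l
  rw [Pi.add_apply, structConst_swap i (l q), Pi.zero_apply, neg_smul]
  ring

theorem sum_act_act_metric_mul (κ z : R) {p q : ℕ} (hpq : p ≠ q) {G : (ℕ → Fin 4) → R}
    (hG : ∀ l u, G (update l p u) = G l) :
    ∑ i, act R i p (act R i p (fun l => metric κ z (l p) (l q) * G l)) =
      (-2 : R) • fun l => metric κ 0 (l p) (l q) * G l := by
  have h : ∀ a b : Fin 4, ∑ i, ∑ u, structConst i u a * structConst i b u =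
      if a = b then (if a = 0 then 0 else -2) else 0 := by decide
  ext l
  simp only [act_metric_mul κ z _ hpq hG, Finset.sum_apply, act_apply, update_self,
    update_of_ne hpq.symm, hG, Pi.smul_apply]
  calc _ = ((∑ i, ∑ u, structConst i u (l p) * structConst i (l q) u : ℤ) : R) * (κ * G l) := by
        push_cast
        simp only [Finset.sum_mul, zsmul_eq_mul, mul_assoc]
    _ = _ := by
        rw [h]
        unfold metric
        split_ifs <;> simp

theorem sum_act_act_metric_mul_metric_mul (κ z : R) {p q p' q' : ℕ} (hpq : p ≠ q)
    (hpq' : p' ≠ q') (hpp' : p ≠ p') (hp'q : p' ≠ q) (hp_q' : p ≠ q')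
    {G : (ℕ → Fin 4) → R} (hp : ∀ l u, G (update l p u) = G l)
    (hp' : ∀ l u, G (update l p' u) = G l) :
    ∑ i, act R i p (act R i p'
        (fun l => metric κ z (l p) (l q) * (metric κ z (l p') (l q') * G l))) =
      fun l => (metric κ 0 (l p) (l p') * metric κ 0 (l q) (l q') -
        metric κ 0 (l p) (l q') * metric κ 0 (l q) (l p')) * G l := by
  have h : ∀ a b a' b' : Fin 4, ∑ i, structConst i b a * structConst i b' a' =
      (if a = a' then (if a = 0 then 0 else 1) else 0) *
        (if b = b' then (if b = 0 then 0 else 1) else 0) -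
      (if a = b' then (if a = 0 then 0 else 1) else 0) *
        (if b = a' then (if b = 0 then 0 else 1) else 0) := by decide
  have hm : ∀ a b : Fin 4, metric κ 0 a b =
      ((if a = b then (if a = 0 then 0 else 1) else 0 : ℤ) : R) * κ := by
    intro a b
    unfold metric
    split_ifs <;> simp
  have e : ∀ i, act R i p (act R i p'
      (fun l => metric κ z (l p) (l q) * (metric κ z (l p') (l q') * G l))) =
      fun l => (structConst i (l q) (l p) • κ) * ((structConst i (l q') (l p') • κ) * G l) := by
    intro i
    have e1 : (fun l : ℕ → Fin 4 => metric κ z (l p) (l q) * (metric κ z (l p') (l q') * G l)) =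
        fun l => metric κ z (l p') (l q') * (metric κ z (l p) (l q) * G l) := by
      ext l; ring
    rw [e1, act_metric_mul κ z i hpq' (by
      intro l u; rw [update_of_ne hpp', update_of_ne hp'q.symm, hp'])]
    have e2 : (fun l : ℕ → Fin 4 => (structConst i (l q') (l p') • κ) *
        (metric κ z (l p) (l q) * G l)) =
        fun l => metric κ z (l p) (l q) * ((structConst i (l q') (l p') • κ) * G l) := by
      ext l; ring
    rw [e2, act_metric_mul κ z i hpq (by
      intro l u; rw [update_of_ne hpp'.symm, update_of_ne hp_q'.symm, hp])]
  ext l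
  simp only [e, Finset.sum_apply, hm]
  calc _ = ((∑ i, structConst i (l q) (l p) * structConst i (l q') (l p') : ℤ) : R) *
        (κ * (κ * G l)) := by
        push_cast
        rw [Finset.sum_mul]
        refine Finset.sum_congr rfl fun i _ => ?_
        simp only [zsmul_eq_mul]
        ring
    _ = _ := by
        rw [h]
        push_cast
        ring

theorem chordTensor_update (κ z : R) {D : Finset (ℕ × ℕ)} {p : ℕ} (hp : p ∉ endpoints D)
    (l : ℕ → Fin 4) (u : Fin 4) : chordTensor κ z D (update l p u) = chordTensor κ z D l := by
  refine Finset.prod_congr rfl fun x hx => ?_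
  rw [update_of_ne, update_of_ne]
  · rintro rfl; exact hp (snd_mem_endpoints hx)
  · rintro rfl; exact hp (fst_mem_endpoints hx)

theorem chordTensor_insert_join (κ z : R) {D : Finset (ℕ × ℕ)} {u v : ℕ} (hu : u ∉ endpoints D) :
    chordTensor κ z (insert (join u v) D) =
      fun l => metric κ z (l u) (l v) * chordTensor κ z D l := by
  ext l
  rw [chordTensor_insert _ _ (join_notMem hu)]
  rcases join_cases u v with h | h <;> rw [h]
  rw [metric_symm]

theorem act_add_act_chordTensor (κ z : R) (i : Fin 4) {D : Finset (ℕ × ℕ)} (hD : IsDiagram D)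
    {x : ℕ × ℕ} (hx : x ∈ D) :
    act R i x.1 (chordTensor κ z D) + act R i x.2 (chordTensor κ z D) = 0 := by
  have h := hD.notMem_endpoints (Finset.erase_subset x D) hx (Finset.notMem_erase x D)
  have hxlt := hD.1 x hx
  have e : chordTensor κ z D =
      fun l => metric κ z (l x.1) (l x.2) * chordTensor κ z (D.erase x) l := by
    ext l
    exact (Finset.mul_prod_erase D _ hx).symm
  rw [e]
  exact act_add_act_metric_mul κ z i hxlt.ne (chordTensor_update κ z h.1)
    (chordTensor_update κ z h.2)

theorem actSum_endpoints_chordTensor (κ z : R) (i : Fin 4) {D : Finset (ℕ × ℕ)}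
    (hD : IsDiagram D) : actSum R i (endpoints D) (chordTensor κ z D) = 0 := by
  rw [actSum, LinearMap.sum_apply, hD.sum_endpoints]
  exact Finset.sum_eq_zero fun x hx => act_add_act_chordTensor κ z i hD hx

/-- The action on the left slots of a chord diagram comes from the chords that cross. -/
theorem actSum_left_chordTensor (κ z : R) (i : Fin 4) {D : Finset (ℕ × ℕ)} (hD : IsDiagram D)
    {a : ℕ × ℕ} (ha : a.1 < a.2) (ha1 : a.1 ∉ endpoints D) (ha2 : a.2 ∉ endpoints D) :
    actSum R i ((endpoints D).filter fun r => a.1 < r ∧ r < a.2) (chordTensor κ z D) =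
      ∑ x ∈ D.filter (Crosses a), act R i (leftEnd a x) (chordTensor κ z D) := by
  rw [actSum, LinearMap.sum_apply, Finset.sum_filter, hD.sum_endpoints, Finset.sum_filter]
  refine Finset.sum_congr rfl fun x hx => ?_
  have h := act_add_act_chordTensor κ z i hD hx
  have hlt := hD.1 x hx
  have n1 : x.1 ≠ a.1 := fun h => ha1 (h ▸ fst_mem_endpoints hx)
  have n2 : x.1 ≠ a.2 := fun h => ha2 (h ▸ fst_mem_endpoints hx)
  have n3 : x.2 ≠ a.1 := fun h => ha1 (h ▸ snd_mem_endpoints hx)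
  have n4 : x.2 ≠ a.2 := fun h => ha2 (h ▸ snd_mem_endpoints hx)
  by_cases c1 : a.1 < x.1 ∧ x.1 < a.2 <;> by_cases c2 : a.1 < x.2 ∧ x.2 < a.2
  · rw [if_pos c1, if_pos c2, h, if_neg (by unfold Crosses; omega)]
  · rw [if_pos c1, if_neg c2, if_pos (by unfold Crosses; omega), leftEnd, if_pos c1, add_zero]
  · rw [if_neg c1, if_pos c2, if_pos (by unfold Crosses; omega), leftEnd, if_neg c1, zero_add]
  · rw [if_neg c1, if_neg c2, if_neg (by unfold Crosses; omega), add_zero]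

/-- The weight of a chord diagram, with the value `z` on the label `0`. -/
def wt (X : Fin 4 → A) (κ z : R) (D : Finset (ℕ × ℕ)) : A :=
  eval R X (cutSort 0 (endpoints D)) (chordTensor κ z D)

/-- The weight does not depend on the point at which the circle is cut. -/
theorem eval_cutSort {X : Fin 4 → A} (hX : IsRep X) (κ z : R) {D : Finset (ℕ × ℕ)}
    (hD : IsDiagram D) (t : ℕ) :
    eval R X (cutSort t (endpoints D)) (chordTensor κ z D) = wt X κ z D := by
  rw [wt, cutSort_zero_eq_append t]
  have hn := nodup_cutSort t (endpoints D)
  have hs := toFinset_cutSort t (endpoints D)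
  rw [cutSort] at hn hs ⊢
  refine eval_rotate hX _ _ hn fun i => ?_
  rw [hs]
  exact actSum_endpoints_chordTensor κ z i hD

theorem eval_cutSort_mul {X : Fin 4 → A} (hX : IsRep X) (h0 : X 0 = 1) (κ z : R)
    {D T : Finset (ℕ × ℕ)} (hD : IsDiagram D) {E : Finset ℕ}
    (hE : ∀ p, p ∈ endpoints D ↔ p ∈ E ∧ p ∉ endpoints T) (t : ℕ) :
    eval R X (cutSort t E) (fun l => chordTensor 0 1 T l * chordTensor κ z D l) =
      wt X κ z D := by
  have h : E.filter (· ∉ endpoints T) = endpoints D := by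
    ext p
    rw [Finset.mem_filter, hE]
  rw [eval_chordTensor_zero_one_mul h0 (nodup_cutSort t E), filter_cutSort, h,
    eval_cutSort hX κ z hD]

theorem eval_cutSort_metric_mul {X : Fin 4 → A} (hX : IsRep X) (h0 : X 0 = 1) (κ z : R)
    {D : Finset (ℕ × ℕ)} (hD : IsDiagram D) {E : Finset ℕ} {u v : ℕ}
    (hE : ∀ p, p ∈ endpoints D ↔ p ∈ E ∧ p ≠ u ∧ p ≠ v) (t : ℕ) :
    eval R X (cutSort t E) (fun l => metric 0 1 (l u) (l v) * chordTensor κ z D l) =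
      wt X κ z D := by
  rw [← eval_cutSort_mul hX h0 κ z (T := {(u, v)}) (E := E) hD _ t]
  · simp [chordTensor]
  · intro p
    rw [hE]
    simp [endpoints]

end Tensors

end ChordTensor

namespace ChordTensor

open Function Chord

section Recurrence

variable {R A : Type*} [CommRing R] [Ring A] [Algebra R A]

theorem sum_sum_eq_diag_add {M : Type*} [AddCommMonoid M] {k : ℕ} (T : Fin k → Fin k → M) :
    ∑ i, ∑ j, T i j = ∑ i, T i i + ∑ i, ∑ j ∈ Finset.Ioi i, (T i j + T j i) := by
  rw [Finset.sum_sum_Ioi_add_eq_sum_sum_off_diag (fun i j => T j i), ← Finset.sum_add_distrib]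
  exact Finset.sum_congr rfl fun i _ => Fintype.sum_eq_add_sum_compl i _

theorem sum_actSum_actSum {k : ℕ} (lft : Fin k → ℕ) (S : Finset ℕ) (F : (ℕ → Fin 4) → R)
    (hS : ∀ i, actSum R i S F = ∑ j, act R i (lft j) F) :
    ∑ i, actSum R i S (actSum R i S F) =
      ∑ j, ∑ j', ∑ i, act R i (lft j) (act R i (lft j') F) := by
  have h : ∀ i, actSum R i S (actSum R i S F) =
      ∑ j, ∑ j', act R i (lft j) (act R i (lft j') F) := by
    intro i
    rw [hS, map_sum]
    have e : ∀ j, actSum R i S (act R i (lft j) F) = act R i (lft j) (actSum R i S F) := by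
      intro j
      have hc : Commute (actSum R (M := R) i S) (act R i (lft j)) :=
        Commute.sum_left _ _ _ fun p _ => commute_act_act_same i p _
      exact congrArg (fun T : Module.End R ((ℕ → Fin 4) → R) => T F) hc.eq
    simp only [e, hS, map_sum]
  simp only [h]
  rw [Finset.sum_comm]
  exact Finset.sum_congr rfl fun j _ => Finset.sum_comm

theorem metric_zero_eq (κ y : R) (u v : Fin 4) :
    metric κ 0 u v = metric κ (-y) u v + y * metric 0 1 u v := by
  rw [← metric_add, neg_add_cancel]

theorem metric_zero_one_mul (u v u' v' : Fin 4) :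
    (metric 0 1 u v * metric 0 1 u' v' : R) = metric 0 1 u v' * metric 0 1 v u' := by
  unfold metric
  have h : ∀ u v u' v' : Fin 4,
      (if u = v then if u = 0 then 1 else 0 else 0 : ℤ) *
        (if u' = v' then if u' = 0 then 1 else 0 else 0) =
      (if u = v' then if u = 0 then 1 else 0 else 0) *
        (if v = u' then if v = 0 then 1 else 0 else 0) := by decide
  have h' := congrArg (Int.cast : ℤ → R) (h u v u' v')
  push_cast at h'
  exact h'

/-- The contribution of one chord `b` that crosses the chord `a`. -/
theorem eval_sum_act_act_same {X : Fin 4 → A} (hX : IsRep X) (h0 : X 0 = 1) (κ y : R)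
    {D : Finset (ℕ × ℕ)} (hD : IsDiagram D) (a : ℕ × ℕ) {b : ℕ × ℕ} (hb : b ∈ D) (t : ℕ) :
    eval R X (cutSort t (endpoints D))
        (∑ i, act R i (leftEnd a b) (act R i (leftEnd a b) (chordTensor κ (-y) D))) =
      (-2 : R) • (wt X κ (-y) D + y • wt X κ (-y) (D.erase b)) := by
  have hlt := hD.1 b hb
  have hE := hD.mono (Finset.erase_subset b D)
  have hn := hD.notMem_endpoints (Finset.erase_subset b D) hb (Finset.notMem_erase b D)
  have hne := leftEnd_ne_rightEnd a hlt
  have hins : D = insert (join (leftEnd a b) (rightEnd a b)) (D.erase b) := by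
    rw [join_leftEnd_rightEnd a hlt, Finset.insert_erase hb]
  have hl : leftEnd a b ∉ endpoints (D.erase b) := by
    unfold leftEnd; split_ifs
    exacts [hn.1, hn.2]
  have hr : rightEnd a b ∉ endpoints (D.erase b) := by
    unfold rightEnd; split_ifs
    exacts [hn.2, hn.1]
  have hends : ∀ p, p ∈ endpoints (D.erase b) ↔
      p ∈ endpoints D ∧ p ≠ leftEnd a b ∧ p ≠ rightEnd a b := by
    intro p
    have h := mem_endpoints_insert_join (D := D.erase b) (u := leftEnd a b) (v := rightEnd a b)
      (p := p)
    rw [← hins] at h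
    rw [h]
    constructor
    · intro hp
      exact ⟨Or.inr (Or.inr hp), fun h => hl (h ▸ hp), fun h => hr (h ▸ hp)⟩
    · tauto
  have hF : chordTensor κ (-y) D = fun l => metric κ (-y) (l (leftEnd a b)) (l (rightEnd a b)) *
      chordTensor κ (-y) (D.erase b) l := by
    rw [← chordTensor_insert_join κ (-y) hl, ← hins]
  have hsum : (fun l : ℕ → Fin 4 => metric κ 0 (l (leftEnd a b)) (l (rightEnd a b)) *
      chordTensor κ (-y) (D.erase b) l) = chordTensor κ (-y) D +
        y • fun l => metric 0 1 (l (leftEnd a b)) (l (rightEnd a b)) *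
          chordTensor κ (-y) (D.erase b) l := by
    rw [hF]
    ext l
    rw [metric_zero_eq κ y]
    simp only [Pi.add_apply, Pi.smul_apply, smul_eq_mul]
    ring
  rw [hF, sum_act_act_metric_mul κ (-y) hne (chordTensor_update κ _ hl), hsum, map_smul, map_add,
    map_smul, eval_cutSort hX κ _ hD, eval_cutSort_metric_mul hX h0 κ _ hE hends]

theorem endpoints_insert_join (E : Finset (ℕ × ℕ)) (u v : ℕ) :
    endpoints (insert (join u v) E) = insert u (insert v (endpoints E)) := by
  ext r
  rw [mem_endpoints_insert_join, Finset.mem_insert, Finset.mem_insert]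

theorem mem_insert_insert_iff_of_notMem {e : Finset ℕ} {u v u' v' : ℕ} (huu' : u ≠ u')
    (huv' : u ≠ v') (hvu' : v ≠ u') (hvv' : v ≠ v') (hu' : u' ∉ e) (hv' : v' ∉ e) (r : ℕ) :
    r ∈ insert u (insert v e) ↔
      r ∈ insert u (insert v (insert u' (insert v' e))) ∧ r ≠ u' ∧ r ≠ v' := by
  simp only [Finset.mem_insert]
  constructor
  · rintro (rfl | rfl | h)
    · exact ⟨Or.inl rfl, huu', huv'⟩
    · exact ⟨Or.inr (Or.inl rfl), hvu', hvv'⟩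
    · exact ⟨Or.inr (Or.inr (Or.inr (Or.inr h))), fun h' => hu' (h' ▸ h), fun h' => hv' (h' ▸ h)⟩
  · rintro ⟨h | h | h | h | h, h1, h2⟩
    exacts [Or.inl h, Or.inr (Or.inl h), absurd h h1, absurd h h2, Or.inr (Or.inr h)]

/-- The contribution of two chords `b, b'` that cross the chord `a`. -/
theorem eval_sum_act_act {X : Fin 4 → A} (hX : IsRep X) (h0 : X 0 = 1) (κ y : R)
    {D : Finset (ℕ × ℕ)} {a b b' : ℕ × ℕ} (hD : IsDiagram (D.erase a)) (hb : b ∈ D.erase a)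
    (hb' : b' ∈ D.erase a) (hbb' : b ≠ b') (t : ℕ) :
    eval R X (cutSort t (endpoints (D.erase a)))
        (∑ i, act R i (leftEnd a b) (act R i (leftEnd a b') (chordTensor κ (-y) (D.erase a)))) =
      wt X κ (-y) (parallel D a b b') - wt X κ (-y) (crossed D a b b') -
        y • (wt X κ (-y) (insert (join (leftEnd a b) (rightEnd a b')) (erase₃ D a b b')) +
          wt X κ (-y) (insert (join (rightEnd a b) (leftEnd a b')) (erase₃ D a b b')) -
          wt X κ (-y) (insert (join (leftEnd a b) (leftEnd a b')) (erase₃ D a b b')) -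
          wt X κ (-y) (insert (join (rightEnd a b) (rightEnd a b')) (erase₃ D a b b'))) := by
  have hlt := hD.1 b hb
  have hlt' := hD.1 b' hb'
  have hsub' : erase₃ D a b b' ⊆ (D.erase a).erase b := Finset.erase_subset _ _
  have hsub : erase₃ D a b b' ⊆ D.erase a := hsub'.trans (Finset.erase_subset _ _)
  have hE := hD.mono hsub
  have hn := hD.notMem_endpoints hsub hb (by simp [erase₃])
  have hn' := hD.notMem_endpoints hsub hb' (by simp [erase₃])
  have hdis := hD.2 b hb b' hb' hbb'
  have hins : D.erase a = insert (join (leftEnd a b) (rightEnd a b))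
      (insert (join (leftEnd a b') (rightEnd a b')) (erase₃ D a b b')) := by
    rw [join_leftEnd_rightEnd a hlt, join_leftEnd_rightEnd a hlt', erase₃,
      Finset.insert_erase (Finset.mem_erase.2 ⟨hbb'.symm, hb'⟩), Finset.insert_erase hb]
  rw [parallel, crossed]
  have hpq := leftEnd_ne_rightEnd a hlt
  have hpq' := leftEnd_ne_rightEnd a hlt'
  have hp : leftEnd a b ∉ endpoints (erase₃ D a b b') := by
    unfold leftEnd; split_ifs
    exacts [hn.1, hn.2]
  have hq : rightEnd a b ∉ endpoints (erase₃ D a b b') := by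
    unfold rightEnd; split_ifs
    exacts [hn.2, hn.1]
  have hp' : leftEnd a b' ∉ endpoints (erase₃ D a b b') := by
    unfold leftEnd; split_ifs
    exacts [hn'.1, hn'.2]
  have hq' : rightEnd a b' ∉ endpoints (erase₃ D a b b') := by
    unfold rightEnd; split_ifs
    exacts [hn'.2, hn'.1]
  have hpp' : leftEnd a b ≠ leftEnd a b' := by
    unfold leftEnd; split_ifs
    exacts [hdis.1, hdis.2.1, hdis.2.2.1, hdis.2.2.2]
  have hqq' : rightEnd a b ≠ rightEnd a b' := by
    unfold rightEnd; split_ifs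
    exacts [hdis.2.2.2, hdis.2.2.1, hdis.2.1, hdis.1]
  have hp_q' : leftEnd a b ≠ rightEnd a b' := by
    unfold leftEnd rightEnd; split_ifs
    exacts [hdis.2.1, hdis.1, hdis.2.2.2, hdis.2.2.1]
  have hq_p' : rightEnd a b ≠ leftEnd a b' := by
    unfold leftEnd rightEnd; split_ifs
    exacts [hdis.2.2.1, hdis.2.2.2, hdis.1, hdis.2.1]
  rw [hins]
  generalize erase₃ D a b b' = E at *
  generalize leftEnd a b = p at *
  generalize leftEnd a b' = p' at *
  generalize rightEnd a b = q at *
  generalize rightEnd a b' = q' at *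
  have hsplit : ∀ {u v u' v' : ℕ}, u ∉ endpoints E → u' ∉ endpoints E → u ≠ u' → u ≠ v' →
      chordTensor κ (-y) (insert (join u v) (insert (join u' v') E)) =
        fun l => metric κ (-y) (l u) (l v) *
          (metric κ (-y) (l u') (l v') * chordTensor κ (-y) E l) := by
    intro u v u' v' hu hu' huu' huv'
    rw [chordTensor_insert_join κ _ (by
      simp only [mem_endpoints_insert_join, huu', huv', hu, or_self, not_false_eq_true]),
      chordTensor_insert_join κ _ hu']
  have hdiag : ∀ {u v u' v' : ℕ}, u ∉ endpoints E → v ∉ endpoints E → u' ∉ endpoints E →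
      v' ∉ endpoints E → u ≠ v → u' ≠ v' → u ≠ u' → u ≠ v' → v ≠ u' → v ≠ v' →
      IsDiagram (insert (join u v) (insert (join u' v') E)) := by
    intro u v u' v' hu hv hu' hv' huv huv2 huu' huv' hvu' hvv'
    refine (hE.insert_join huv2 hu' hv').insert_join huv ?_ ?_ <;>
      simp only [mem_endpoints_insert_join, huu', huv', hu, hv, hvu', hvv', or_self,
        not_false_eq_true]
  have hpar := hdiag hp hp' hq hq' hpp' hqq' hpq hp_q' hq_p'.symm hpq'
  have hcro := hdiag hp hq' hq hp' hp_q' hq_p' hpq hpp' hqq'.symm hpq'.symm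
  have hpar' : endpoints (insert (join p q) (insert (join p' q') E)) =
      endpoints (insert (join p p') (insert (join q q') E)) := by
    simp only [endpoints_insert_join]
    rw [Finset.insert_comm q p']
  have hcro' : endpoints (insert (join p q) (insert (join p' q') E)) =
      endpoints (insert (join p q') (insert (join q p') E)) := by
    simp only [endpoints_insert_join]
    rw [Finset.insert_comm p' q', Finset.insert_comm q q']
  have hone : ∀ {u v u' v' : ℕ}, u ≠ v → u ≠ u' → u ≠ v' → v ≠ u' → v ≠ v' →
      u ∉ endpoints E → v ∉ endpoints E → u' ∉ endpoints E → v' ∉ endpoints E →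
      (insert p (insert q (insert p' (insert q' (endpoints E)))) =
        insert u (insert v (insert u' (insert v' (endpoints E))))) →
      eval R X (cutSort t (endpoints (insert (join p q) (insert (join p' q') E))))
        (fun l => metric 0 1 (l u') (l v') * (metric κ (-y) (l u) (l v) *
          chordTensor κ (-y) E l)) = wt X κ (-y) (insert (join u v) E) := by
    intro u v u' v' huv huu' huv' hvu' hvv' hu hv hu' hv' hr
    rw [← eval_cutSort_metric_mul hX h0 κ (-y) (hE.insert_join huv hu hv)
      (E := endpoints (insert (join p q) (insert (join p' q') E))) (u := u') (v := v') _ t,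
      chordTensor_insert_join κ _ hu]
    intro r
    rw [endpoints_insert_join, endpoints_insert_join, endpoints_insert_join, hr]
    exact mem_insert_insert_iff_of_notMem huu' huv' hvu' hvv' hu' hv' r
  have e1 := hone (u := p) (v := p') (u' := q) (v' := q') hpp' hpq hp_q' hq_p'.symm hpq'
    hp hp' hq hq' (by rw [Finset.insert_comm q p'])
  have e2 := hone (u := q) (v := q') (u' := p) (v' := p') hqq' hpq.symm hq_p' hp_q'.symm
    hpq'.symm hq hq' hp hp' (by rw [Finset.insert_comm p' q', Finset.insert_comm p q, Finset.insert_comm p q'])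
  have e3 := hone (u := p) (v := q') (u' := q) (v' := p') hp_q' hpq hpp' hqq'.symm
    hpq'.symm hp hq' hq hp' (by rw [Finset.insert_comm p' q', Finset.insert_comm q q'])
  have e4 := hone (u := q) (v := p') (u' := p) (v' := q') hq_p' hpq.symm hqq' hpp'.symm
    hpq' hq hp' hp hq' (by rw [Finset.insert_comm p q, Finset.insert_comm p p'])
  rw [hsplit hp hp' hpp' hp_q',
    sum_act_act_metric_mul_metric_mul κ _ hpq hpq' hpp' hq_p'.symm hp_q'
      (chordTensor_update κ _ hp) (chordTensor_update κ _ hp'),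
    ← eval_cutSort hX κ (-y) hpar t, ← eval_cutSort hX κ (-y) hcro t, ← hpar', ← hcro',
    hsplit hp hq hpq hp_q', hsplit hp hq hpq hpp',
    ← e1, ← e2, ← e3, ← e4]
  simp only [← map_add, ← map_sub, ← map_smul]
  congr 1
  ext l
  simp only [Pi.add_apply, Pi.sub_apply, Pi.smul_apply, smul_eq_mul, metric_zero_eq κ y]
  have hm := metric_zero_one_mul (R := R) (l p) (l p') (l q) (l q')
  rw [metric_symm 0 1 (l p') (l q)] at hm
  linear_combination (y ^ 2 * chordTensor κ (-y) E l) * hm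

/-- The recurrence for the weights with the value `-y` on the label `0`, where `y` is the
Casimir element. -/
theorem two_smul_wt {X : Fin 4 → A} (hX : IsRep X) (h0 : X 0 = 1) {κ y : R}
    (hy : κ • (X 1 * X 1 + X 2 * X 2 + X 3 * X 3) = algebraMap R A y)
    {D : Finset (ℕ × ℕ)} (hD : IsDiagram D) {a : ℕ × ℕ} (ha : a ∈ D)
    {k : ℕ} {b : Fin k → ℕ × ℕ} (hb : Injective b)
    (hb_range : ∀ x, x ∈ Set.range b ↔ x ∈ D ∧ Crosses a x) :
    (2 : R) • wt X κ (-y) D = (2 : R) • κ • ((k : R) • wt X κ (-y) (D.erase a)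
      + y • ∑ i, wt X κ (-y) ((D.erase a).erase (b i))
      - ∑ i, ∑ j ∈ Finset.Ioi i, (wt X κ (-y) (parallel D a (b i) (b j)) -
          wt X κ (-y) (crossed D a (b i) (b j)))
      + y • ∑ i, ∑ j ∈ Finset.Ioi i,
        (wt X κ (-y) (insert (join (leftEnd a (b i)) (rightEnd a (b j))) (erase₃ D a (b i) (b j))) +
        wt X κ (-y) (insert (join (rightEnd a (b i)) (leftEnd a (b j))) (erase₃ D a (b i) (b j))) -
        wt X κ (-y) (insert (join (leftEnd a (b i)) (leftEnd a (b j))) (erase₃ D a (b i) (b j))) -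
        wt X κ (-y)
          (insert (join (rightEnd a (b i)) (rightEnd a (b j))) (erase₃ D a (b i) (b j))))) := by
  have halt := hD.1 a ha
  have hD' := hD.mono (Finset.erase_subset a D)
  have hn := hD.notMem_endpoints (Finset.erase_subset a D) ha (Finset.notMem_erase a D)
  have hnc : ¬ Crosses a a := by unfold Crosses; omega
  have hbD : ∀ i, b i ∈ D.erase a := by
    intro i
    have h := (hb_range (b i)).1 ⟨i, rfl⟩
    exact Finset.mem_erase.2 ⟨fun h' => hnc (h' ▸ h.2), h.1⟩
  have hfilter : (D.erase a).filter (Crosses a) = Finset.univ.image b := by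
    ext x
    have h := hb_range x
    simp only [Finset.mem_filter, Finset.mem_erase, Finset.mem_image, Finset.mem_univ, true_and]
    rw [Set.mem_range] at h
    rw [h]
    constructor
    · rintro ⟨⟨-, hx⟩, hc⟩; exact ⟨hx, hc⟩
    · rintro ⟨hx, hc⟩; exact ⟨⟨fun h' => hnc (h' ▸ hc), hx⟩, hc⟩
  have hins : endpoints D = insert a.1 (insert a.2 (endpoints (D.erase a))) := by
    ext p
    conv_lhs => rw [← Finset.insert_erase ha]
    rw [mem_endpoints_insert, Finset.mem_insert, Finset.mem_insert]
  obtain ⟨L', hL1, hL2⟩ := cutSort_insert_insert halt hn.1 hn.2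
  have hS : ∀ i, actSum R i
      (((endpoints (D.erase a)).filter fun r => a.1 < r ∧ r < a.2).sort (· ≤ ·)).toFinset
        (chordTensor κ (-y) (D.erase a)) =
      ∑ j, act R i (leftEnd a (b j)) (chordTensor κ (-y) (D.erase a)) := by
    intro i
    rw [Finset.sort_toFinset, actSum_left_chordTensor κ _ i hD' halt hn.1 hn.2, hfilter,
      Finset.sum_image fun i _ j _ h => hb h]
  have hF : chordTensor κ (-y) D =
      fun l => metric κ (-y) (l a.1) (l a.2) * chordTensor κ (-y) (D.erase a) l := by
    ext l
    exact (Finset.mul_prod_erase D _ ha).symm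
  have hnodup := nodup_cutSort a.1 (endpoints D)
  rw [hins, hL1] at hnodup
  have key := two_mul_eval_chord hX h0 (z := -y) hy hnodup
    (chordTensor_update κ (-y) hn.1) (chordTensor_update κ (-y) hn.2)
  rw [← hF, ← hL1, ← hins, eval_cutSort hX κ _ hD, ← hL2, ← map_sum,
    sum_actSum_actSum (fun j => leftEnd a (b j)) _ _ hS] at key
  obtain ⟨T, hT⟩ : ∃ T : Fin k → Fin k → (ℕ → Fin 4) → R, T = fun j j' =>
    ∑ i, act R i (leftEnd a (b j)) (act R i (leftEnd a (b j')) (chordTensor κ (-y) (D.erase a))) :=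
    ⟨_, rfl⟩
  have hT1 : ∀ i, eval R X (cutSort a.1 (endpoints (D.erase a))) (T i i) =
      (-2 : R) • (wt X κ (-y) (D.erase a) + y • wt X κ (-y) ((D.erase a).erase (b i))) := by
    intro i
    rw [hT]
    exact eval_sum_act_act_same hX h0 κ y hD' a (hbD i) _
  have hT2 : ∀ i j, T i j + T j i = T i j + T i j := by
    intro i j
    rw [hT]
    refine congrArg (_ + ·) ?_
    exact Finset.sum_congr rfl fun u _ =>
      congrArg (fun T : Module.End R ((ℕ → Fin 4) → R) => T (chordTensor κ (-y) (D.erase a)))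
        (commute_act_act_same u (leftEnd a (b j)) (leftEnd a (b i))).eq
  have hT3 := fun i j (hij : j ∈ Finset.Ioi i) =>
    (congrArg (fun T => eval R X (cutSort a.1 (endpoints (D.erase a))) (T i j)) hT).trans
      (eval_sum_act_act hX h0 κ y hD' (hbD i) (hbD j)
        (fun h => (Finset.mem_Ioi.1 hij).ne (hb h)) a.1)
  have hsum : ∑ j, ∑ j', ∑ i, act R i (leftEnd a (b j)) (act R i (leftEnd a (b j'))
      (chordTensor κ (-y) (D.erase a))) = ∑ j, ∑ j', T j j' := by rw [hT]
  rw [hsum, sum_sum_eq_diag_add] at key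
  simp only [hT2, map_add, map_sum, hT1] at key
  rw [Finset.sum_congr rfl fun i _ => Finset.sum_congr rfl fun j hj =>
    congrArg₂ (· + ·) (hT3 i j hj) (hT3 i j hj)] at key
  simp only [Finset.sum_add_distrib, ← Finset.smul_sum, Finset.sum_sub_distrib, smul_add,
    Finset.sum_const, Finset.card_univ, Fintype.card_fin, ← Nat.cast_smul_eq_nsmul R] at key ⊢
  rw [two_smul R (wt X κ (-y) D), ← two_mul, key]
  module

end Recurrence

end ChordTensor

/-! ### Deframing -/

namespace Chord

open Function

theorem sum_powersetCard_sum_sdiff {α M : Type*} [DecidableEq α] [AddCommMonoid M] (D : Finset α)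
    (m : ℕ) (f : Finset α → M) :
    ∑ T ∈ D.powersetCard m, ∑ a ∈ D \ T, f (insert a T) =
      (m + 1) • ∑ T ∈ D.powersetCard (m + 1), f T := by
  have h : ∀ T ∈ D.powersetCard (m + 1), (m + 1) • f T = ∑ a ∈ T, f T := by
    intro T hT
    rw [Finset.sum_const, (Finset.mem_powersetCard.1 hT).2]
  rw [Finset.smul_sum, Finset.sum_congr rfl h, Finset.sum_sigma', Finset.sum_sigma']
  refine Finset.sum_bij' (fun x _ => ⟨insert x.2 x.1, x.2⟩) (fun x _ => ⟨x.1.erase x.2, x.2⟩)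
    ?_ ?_ ?_ ?_ ?_
  · rintro ⟨T, a⟩ h
    simp only [Finset.mem_sigma, Finset.mem_powersetCard, Finset.mem_sdiff] at h ⊢
    obtain ⟨⟨h1, h2⟩, h3, h4⟩ := h
    exact ⟨⟨Finset.insert_subset h3 h1, by rw [Finset.card_insert_of_notMem h4, h2]⟩,
      Finset.mem_insert_self _ _⟩
  · rintro ⟨T, a⟩ h
    simp only [Finset.mem_sigma, Finset.mem_powersetCard, Finset.mem_sdiff] at h ⊢
    obtain ⟨⟨h1, h2⟩, h3⟩ := h
    exact ⟨⟨(Finset.erase_subset _ _).trans h1, by rw [Finset.card_erase_of_mem h3, h2]; rfl⟩,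
      h1 h3, Finset.notMem_erase _ _⟩
  · rintro ⟨T, a⟩ h
    simp only [Finset.mem_sigma, Finset.mem_sdiff] at h
    simp [Finset.erase_insert h.2.2]
  · rintro ⟨T, a⟩ h
    simp only [Finset.mem_sigma] at h
    simp [Finset.insert_erase h.2]
  · rintro ⟨T, a⟩ _
    rfl

theorem s_pow_diag (K : Type*) [Field K] (D : Finset (ℕ × ℕ)) (m : ℕ) :
    (s K ^ m) (diag K D) = m.factorial • ∑ T ∈ D.powersetCard m, diag K (D \ T) := by
  induction m with
  | zero => simp
  | succ m ih =>
    have hs : ∀ T, s K (diag K (D \ T)) = ∑ a ∈ D \ T, diag K (D \ insert a T) := by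
      intro T
      rw [s, Finsupp.linearCombination_single, one_smul]
      refine Finset.sum_congr rfl fun a _ => ?_
      rw [Finset.sdiff_insert]
    rw [pow_succ', Module.End.mul_apply, ih, map_nsmul, map_sum]
    simp only [hs]
    rw [sum_powersetCard_sum_sdiff D m fun T => diag K (D \ T), smul_smul, Nat.factorial_succ,
      mul_comm]

theorem addIsolated_eq (D : Finset (ℕ × ℕ)) :
    addIsolated D =
      insert (join ((endpoints D).sup id + 1) ((endpoints D).sup id + 2)) D := by
  rw [addIsolated, join_fst_snd (x := (_, _)) (by simp)]

theorem IsDiagram.addIsolated {D : Finset (ℕ × ℕ)} (hD : IsDiagram D) :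
    IsDiagram (addIsolated D) := by
  have h : ∀ p ∈ endpoints D, p ≤ (endpoints D).sup id := fun p hp =>
    Finset.le_sup (f := id) hp
  rw [addIsolated_eq]
  refine hD.insert_join (by simp) (fun hp => ?_) (fun hp => ?_)
  all_goals
    have := h _ hp
    omega

theorem θ_diag (K : Type*) [Field K] (D : Finset (ℕ × ℕ)) :
    θ K (diag K D) = diag K (addIsolated D) := by
  rw [θ, Finsupp.linearCombination_single, one_smul]

end Chord

namespace ChordTensor

open Function Chord

section Deframing

variable {R A : Type*} [CommRing R] [Ring A] [Algebra R A]

theorem wt_add {X : Fin 4 → A} (hX : IsRep X) (h0 : X 0 = 1) (κ z w : R)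
    {D : Finset (ℕ × ℕ)} (hD : IsDiagram D) :
    wt X κ (z + w) D = ∑ T ∈ D.powerset, w ^ T.card • wt X κ z (D \ T) := by
  have h : chordTensor κ (z + w) D = ∑ T ∈ D.powerset,
      w ^ T.card • fun l => chordTensor 0 1 T l * chordTensor κ z (D \ T) l := by
    ext l
    rw [Finset.sum_apply]
    simp only [chordTensor, metric_add, Pi.smul_apply, smul_eq_mul, add_comm (metric κ z _ _)]
    rw [Finset.prod_add]
    refine Finset.sum_congr rfl fun T _ => ?_
    rw [Finset.prod_mul_distrib, Finset.prod_const, mul_assoc]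
  rw [wt, h, map_sum]
  refine Finset.sum_congr rfl fun T hT => ?_
  rw [map_smul, eval_cutSort_mul hX h0 κ z (hD.mono Finset.sdiff_subset)
    (fun p => hD.endpoints_sdiff (Finset.mem_powerset.1 hT))]

theorem wt_addIsolated {X : Fin 4 → A} (hX : IsRep X) (h0 : X 0 = 1) {κ y : R} (z : R)
    (hy : κ • (X 1 * X 1 + X 2 * X 2 + X 3 * X 3) = algebraMap R A y)
    (h2 : ∀ u v : A, 2 * u = 2 * v → u = v) {D : Finset (ℕ × ℕ)} (hD : IsDiagram D) :
    wt X κ z (addIsolated D) = (z + y) • wt X κ z D := by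
  have hle : ∀ p ∈ endpoints D, p ≤ (endpoints D).sup id := fun p hp =>
    Finset.le_sup (f := id) hp
  have hD' := hD.addIsolated
  rw [addIsolated_eq] at hD' ⊢
  generalize (endpoints D).sup id = n at *
  have hn1 : n + 1 ∉ endpoints D := fun h => by have := hle _ h; omega
  have hn2 : n + 2 ∉ endpoints D := fun h => by have := hle _ h; omega
  obtain ⟨L', hL1, hL2⟩ := cutSort_insert_insert (show n + 1 < n + 2 by omega) hn1 hn2
  have he : (endpoints D).filter (fun r => n + 1 < r ∧ r < n + 2) = ∅ :=
    Finset.filter_eq_empty_iff.2 fun r _ => by omega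
  rw [he, Finset.sort_empty] at hL1 hL2
  have hnodup := nodup_cutSort (n + 1) (endpoints (insert (join (n + 1) (n + 2)) D))
  rw [endpoints_insert_join, hL1] at hnodup
  have key := two_mul_eval_chord hX h0 (z := z) hy hnodup
    (chordTensor_update κ z hn1) (chordTensor_update κ z hn2)
  rw [← hL1, ← endpoints_insert_join, ← chordTensor_insert_join κ z hn1, ← hL2,
    eval_cutSort hX κ z hD, eval_cutSort hX κ z hD'] at key
  refine h2 _ _ (key.trans ?_)
  simp only [actSum, List.toFinset_nil, Finset.sum_empty, LinearMap.zero_apply, map_zero,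
    Finset.sum_const_zero, smul_zero, sub_zero]
  rw [mul_smul, two_smul, two_mul]

/-- Deframing replaces the value `z` on the label `0` by `-y`. -/
theorem map_φ_diag {K : Type*} [Field K] [CharZero K] [Algebra K A] {X : Fin 4 → A}
    (hX : IsRep X) (h0 : X 0 = 1) {κ y z : R}
    (hy : κ • (X 1 * X 1 + X 2 * X 2 + X 3 * X 3) = algebraMap R A y)
    (h2 : ∀ u v : A, 2 * u = 2 * v → u = v) (w : Comb K →ₗ[K] A)
    (hw : ∀ D, IsDiagram D → w (diag K D) = wt X κ z D) {D : Finset (ℕ × ℕ)} (hD : IsDiagram D) :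
    w (φ K (diag K D)) = wt X κ (-y) D := by
  have hθ : ∀ m, ∀ J, IsDiagram J → w ((θ K ^ m) (diag K J)) = (z + y) ^ m • wt X κ z J := by
    intro m
    induction m with
    | zero => intro J hJ; simp [hw J hJ]
    | succ m ih =>
      intro J hJ
      rw [pow_succ, Module.End.mul_apply, θ_diag, ih _ hJ.addIsolated,
        wt_addIsolated hX h0 z hy h2 hJ, smul_smul, pow_succ]
  have hz : -y = z + -(z + y) := by ring
  rw [φ, Finsupp.linearCombination_single, one_smul, map_sum, hz, wt_add hX h0 κ z _ hD,
    Finset.sum_powerset]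
  refine Finset.sum_congr rfl fun m _ => ?_
  have hm : (m.factorial : K) ≠ 0 := Nat.cast_ne_zero.2 m.factorial_ne_zero
  rw [map_smul, s_pow_diag, map_nsmul, map_nsmul, ← Nat.cast_smul_eq_nsmul K, smul_smul,
    div_mul_cancel₀ _ hm, map_sum, map_sum, Finset.smul_sum]
  refine Finset.sum_congr rfl fun T hT => ?_
  rw [hθ m _ (hD.mono Finset.sdiff_subset), (Finset.mem_powersetCard.1 hT).2, neg_pow (z + y)]
  rcases Nat.even_or_odd m with hm | hm <;> simp [hm.neg_one_pow]

end Deframing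

end ChordTensor

namespace ChordTensor

open Function Chord

/-! ### Evaluation as a sum over labellings -/

section Labels

variable {R A : Type*} [CommRing R] [Ring A] [Algebra R A]

/-- A labelling of the positions in `E`, extended to all positions by `l₀`. -/
def extendBy {E : Finset ℕ} (l₀ : ℕ → Fin 4) (l : E → Fin 4) (p : ℕ) : Fin 4 :=
  if h : p ∈ E then l ⟨p, h⟩ else l₀ p

theorem sum_extendBy_insert {M : Type*} [AddCommMonoid M] {E : Finset ℕ} {p : ℕ} (hp : p ∉ E)
    (l₀ : ℕ → Fin 4) (h : (ℕ → Fin 4) → M) :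
    ∑ l : {q // q ∈ insert p E} → Fin 4, h (extendBy l₀ l) =
      ∑ u, ∑ l : E → Fin 4, h (extendBy (update l₀ p u) l) := by
  rw [← Fintype.sum_prod_type' (f := fun u (l : E → Fin 4) => h (extendBy (update l₀ p u) l))]
  refine Finset.sum_bij' (fun l _ => (l ⟨p, Finset.mem_insert_self _ _⟩,
      fun x => l ⟨x.1, Finset.mem_insert_of_mem x.2⟩))
    (fun x _ q => if hq : q.1 ∈ E then x.2 ⟨q.1, hq⟩ else x.1) ?_ ?_ ?_ ?_ ?_
  · simp
  · simp
  · intro l _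
    funext q
    by_cases hq : q.1 ∈ E
    · simp [hq]
    · obtain rfl : q = ⟨p, Finset.mem_insert_self _ _⟩ :=
        Subtype.ext ((Finset.mem_insert.1 q.2).resolve_right hq)
      simp [hp]
  · rintro ⟨u, l⟩ _
    simp [hp]
  · intro l _
    congr 1
    funext q
    by_cases hq : q ∈ E
    · simp [extendBy, hq]
    · by_cases hqp : q = p
      · subst hqp; simp [extendBy, hp]
      · simp [extendBy, hq, hqp]

theorem word_eq_sum (X : Fin 4 → A) {P : List ℕ} (hP : P.Nodup) {E : Finset ℕ}
    (hE : P.toFinset = E) (F : (ℕ → Fin 4) → A) (l₀ : ℕ → Fin 4) :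
    word R X P F l₀ = ∑ l : E → Fin 4,
      (P.map fun p => X (extendBy l₀ l p)).prod * F (extendBy l₀ l) := by
  induction P generalizing E l₀ with
  | nil =>
    subst hE
    have h : ∀ l : ([] : List ℕ).toFinset → Fin 4, extendBy l₀ l = l₀ := by
      intro l; funext p; simp [extendBy]
    rw [word_nil, Module.End.one_apply]
    simp only [h, List.map_nil, List.prod_nil, one_mul, Finset.sum_const, Finset.card_univ]
    simp
  | cons p P ih =>
    obtain ⟨hp, hP⟩ := List.nodup_cons.1 hP
    have hp' : p ∉ P.toFinset := by simpa using hp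
    rw [List.toFinset_cons] at hE
    subst hE
    rw [sum_extendBy_insert hp' l₀ fun l =>
        ((p :: P).map fun p => X (l p)).prod * F l, word_cons,
      Module.End.mul_apply, step_apply]
    refine Finset.sum_congr rfl fun u _ => ?_
    rw [ih hP rfl, Finset.mul_sum]
    refine Finset.sum_congr rfl fun l _ => ?_
    have h : extendBy (update l₀ p u) l p = u := by simp [extendBy, hp]
    rw [List.map_cons, List.prod_cons, h, mul_assoc]

theorem eval_cutOpen_eq_sum (X : Fin 4 → A) (t : ℕ) (D : Finset (ℕ × ℕ))
    (F : (ℕ → Fin 4) → R) :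
    eval R X (cutOpen t D) F = ∑ l : endpoints D → Fin 4,
      ((cutOpen t D).map fun p => X (extend l p)).prod * algebraMap R A (F (extend l)) := by
  rw [eval_apply, cutOpen_eq, word_eq_sum X (nodup_cutSort t (endpoints D)) (toFinset_cutSort t _)]
  rfl

end Labels

/-! ### Products of quaternion units along a chord diagram -/

section Signs

variable {K A : Type*} [Field K] [Ring A] [Algebra K A]

theorem phase_comm (a b : Fin 4) : A1.phase K a b = A1.phase K b a := by
  have h : ∀ a b : Fin 4,
      ((A1.deg a).1 * (A1.deg b).2 - (A1.deg a).2 * (A1.deg b).1).val =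
        ((A1.deg b).1 * (A1.deg a).2 - (A1.deg b).2 * (A1.deg a).1).val := by decide
  rw [A1.phase, A1.phase, h]

theorem phase_mul_self (a b : Fin 4) : A1.phase K a b * A1.phase K a b = 1 := by
  rw [A1.phase, ← mul_pow]
  simp

/-- The product of the commuting factors over all pairs of intersecting chords. -/
def crossingSign (K : Type*) [Field K] (D : Finset (ℕ × ℕ)) (l : ℕ → Fin 4) : K :=
  ∏ p ∈ (D ×ˢ D).filter (fun p => p.1.1 < p.2.1 ∧ Crosses p.1 p.2),
    A1.phase K (l p.1.2) (l p.2.1)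

theorem crossingSign_insert {D : Finset (ℕ × ℕ)} {x : ℕ × ℕ} (hx : x ∉ D) {l : ℕ → Fin 4}
    (hl : ∀ z ∈ insert x D, l z.2 = l z.1) :
    crossingSign K (insert x D) l =
      (∏ z ∈ D, if Crosses x z then A1.phase K (l x.1) (l z.1) else 1) * crossingSign K D l := by
  have hxl := hl x (Finset.mem_insert_self _ _)
  simp only [crossingSign, Finset.prod_filter, Finset.prod_product, Finset.prod_insert hx,
    lt_self_iff_false, false_and, if_false, one_mul]
  rw [Finset.prod_mul_distrib, ← mul_assoc, ← Finset.prod_mul_distrib]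
  congr 1
  refine Finset.prod_congr rfl fun z hz => ?_
  have hzl := hl z (Finset.mem_insert_of_mem hz)
  rw [hxl, hzl, phase_comm (l z.1)]
  by_cases hc : Crosses x z
  · have hc' : Crosses z x := Or.symm hc
    rcases lt_trichotomy x.1 z.1 with h | h | h
    · simp [hc, h, h.not_gt]
    · unfold Crosses at hc; omega
    · simp [hc, hc', h, h.not_gt]
  · have hc' : ¬ Crosses z x := fun h => hc (Or.symm h)
    simp [hc, hc']

/-- Units that commute up to the commuting factors and square to scalars. -/
structure IsUnits (e : Fin 4 → A) (sq : Fin 4 → K) : Prop where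
  swap : ∀ a b, e a * e b = A1.phase K a b • (e b * e a)
  mul_self : ∀ a, e a * e a = algebraMap K A (sq a)
  sq_ne_zero : ∀ a, sq a ≠ 0

variable {e : Fin 4 → A} {sq : Fin 4 → K}

theorem IsUnits.isUnit_prod (he : IsUnits e sq) (P : List ℕ) (l : ℕ → Fin 4) :
    IsUnit (P.map fun p => e (l p)).prod := by
  refine List.prod_isUnit fun x hx => ?_
  obtain ⟨p, -, rfl⟩ := List.mem_map.1 hx
  have h : IsUnit (e (l p) * e (l p)) := by
    rw [he.mul_self]
    exact (IsUnit.mk0 _ (he.sq_ne_zero _)).map (algebraMap K A)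
  exact ((Commute.refl (e (l p))).isUnit_mul_iff.1 h).1

theorem IsUnits.mul_prod (he : IsUnits e sq) (k : Fin 4) (P : List ℕ) (l : ℕ → Fin 4) :
    e k * (P.map fun p => e (l p)).prod =
      (P.map fun p => A1.phase K k (l p)).prod • ((P.map fun p => e (l p)).prod * e k) := by
  induction P with
  | nil => simp
  | cons p P ih =>
    simp only [List.map_cons, List.prod_cons]
    rw [← mul_assoc, he.swap, smul_mul_assoc, mul_assoc, ih, mul_smul_comm, smul_smul, mul_assoc]

theorem mul_eq_algebraMap_comm {u v : A} (hu : IsUnit u) {c : K}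
    (h : u * v = algebraMap K A c) : v * u = algebraMap K A c := by
  obtain ⟨u, rfl⟩ := hu
  have hv : v = ↑u⁻¹ * algebraMap K A c := by rw [← h, Units.inv_mul_cancel_left]
  rw [hv, mul_assoc, Algebra.commutes, Units.inv_mul_cancel_left]

theorem IsUnits.prod_cutSort (he : IsUnits e sq) {E : Finset ℕ} {l : ℕ → Fin 4} {c : K} {t : ℕ}
    (h : ((cutSort t E).map fun p => e (l p)).prod = algebraMap K A c) (t' : ℕ) :
    ((cutSort t' E).map fun p => e (l p)).prod = algebraMap K A c := by
  have h0 : ((cutSort 0 E).map fun p => e (l p)).prod = algebraMap K A c := by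
    rw [cutSort_zero_eq_append t, List.map_append, List.prod_append]
    rw [cutSort, List.map_append, List.prod_append] at h
    exact mul_eq_algebraMap_comm (he.isUnit_prod _ _) h
  rw [cutSort, List.map_append, List.prod_append]
  rw [cutSort_zero_eq_append t', List.map_append, List.prod_append] at h0
  exact mul_eq_algebraMap_comm (he.isUnit_prod _ _) h0

theorem prod_phase {D : Finset (ℕ × ℕ)} (hD : IsDiagram D) {x : ℕ × ℕ}
    (hlt : x.1 < x.2) (h1 : x.1 ∉ endpoints D) (h2 : x.2 ∉ endpoints D)
    {l : ℕ → Fin 4} (hl : ∀ z ∈ D, l z.2 = l z.1) (k : Fin 4) :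
    ((((endpoints D).filter fun r => x.1 < r ∧ r < x.2).sort (· ≤ ·)).map
      fun p => A1.phase K k (l p)).prod =
      ∏ z ∈ D, if Crosses x z then A1.phase K k (l z.1) else 1 := by
  rw [← List.prod_toFinset _ (Finset.sort_nodup _ _), Finset.sort_toFinset, Finset.prod_filter,
    hD.prod_endpoints]
  refine Finset.prod_congr rfl fun z hz => ?_
  have hlt' := hD.1 z hz
  have n1 : z.1 ≠ x.1 := fun h => h1 (h ▸ fst_mem_endpoints hz)
  have n2 : z.1 ≠ x.2 := fun h => h2 (h ▸ fst_mem_endpoints hz)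
  have n3 : z.2 ≠ x.1 := fun h => h1 (h ▸ snd_mem_endpoints hz)
  have n4 : z.2 ≠ x.2 := fun h => h2 (h ▸ snd_mem_endpoints hz)
  rw [hl z hz]
  by_cases c1 : x.1 < z.1 ∧ z.1 < x.2 <;> by_cases c2 : x.1 < z.2 ∧ z.2 < x.2
  · rw [if_pos c1, if_pos c2, phase_mul_self, if_neg (by unfold Crosses; omega)]
  · rw [if_pos c1, if_neg c2, if_pos (by unfold Crosses; omega), mul_one]
  · rw [if_neg c1, if_pos c2, if_pos (by unfold Crosses; omega), one_mul]
  · rw [if_neg c1, if_neg c2, if_neg (by unfold Crosses; omega), mul_one]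

/-- The product of the units along a chord diagram with equally labelled chord ends. -/
theorem IsUnits.prod_cutOpen (he : IsUnits e sq) {D : Finset (ℕ × ℕ)} (hD : IsDiagram D)
    {l : ℕ → Fin 4} (hl : ∀ z ∈ D, l z.2 = l z.1) (t : ℕ) :
    ((cutOpen t D).map fun p => e (l p)).prod =
      algebraMap K A (crossingSign K D l * ∏ x ∈ D, sq (l x.1)) := by
  induction D using Finset.induction_on generalizing t with
  | empty => simp [cutOpen, endpoints, crossingSign]
  | insert x D hx ih =>
    have hsub := Finset.subset_insert x D
    have hD' := hD.mono hsub
    have hl' : ∀ z ∈ D, l z.2 = l z.1 := fun z hz => hl z (hsub hz)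
    have hlt := hD.1 x (Finset.mem_insert_self _ _)
    have hxl := hl x (Finset.mem_insert_self _ _)
    have hn := hD.notMem_endpoints hsub (Finset.mem_insert_self _ _) hx
    obtain ⟨L', hL1, hL2⟩ := cutSort_insert_insert hlt hn.1 hn.2
    have hins : endpoints (insert x D) = insert x.1 (insert x.2 (endpoints D)) := by
      ext p
      rw [mem_endpoints_insert, Finset.mem_insert, Finset.mem_insert]
    have hph := prod_phase (K := K) hD' hlt hn.1 hn.2 hl' (l x.1)
    have ih' := ih hD' hl' x.1
    rw [cutOpen_eq, hL2, List.map_append, List.prod_append] at ih'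
    rw [cutOpen_eq]
    refine he.prod_cutSort (t := x.1) ?_ t
    rw [hins, hL1, List.map_cons, List.map_append, List.map_cons, List.prod_cons,
      List.prod_append, List.prod_cons, ← mul_assoc, he.mul_prod, hph, hxl, smul_mul_assoc,
      mul_assoc, ← mul_assoc (e _) (e _), he.mul_self, Algebra.left_comm, ih',
      Finset.prod_insert hx, crossingSign_insert hx hl, Algebra.smul_def, ← map_mul, ← map_mul]
    congr 1
    ring

end Signs

end ChordTensor

/-! ### The enveloping algebra -/

namespace A1

variable {K A : Type*} [Field K] [Ring A] [Algebra K A] {ε : K}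

theorem Q_mul_Q (a b : Fin 4) :
    Q ε a * Q ε b = phase K a b • (Q ε b * Q ε a) + ∑ c, bracket ε a b c • Q ε c := by
  have h := RingQuot.mkAlgHom_rel K (Rel.swap (ε := ε) a b)
  simp only [map_mul, map_add, map_smul, map_sum] at h
  exact h

variable (ι : U ε →ₐ[K] A)

theorem map_Q_mul_map_Q (a b : Fin 4) : ι (Q ε a) * ι (Q ε b) =
    phase K a b • (ι (Q ε b) * ι (Q ε a)) + ∑ c, bracket ε a b c • ι (Q ε c) := by
  rw [← map_mul, Q_mul_Q, map_add, map_smul, map_mul, map_sum]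
  simp only [map_smul]

theorem map_Q_zero_mul (a : Fin 4) : ι (Q ε 0) * ι (Q ε a) = ι (Q ε a) * ι (Q ε 0) := by
  have h := map_Q_mul_map_Q ι 0 a
  fin_cases a <;> simp [phase, deg, bracket] at h ⊢ <;> exact h

theorem map_Q_one_two : ι (Q ε 1) * ι (Q ε 2) = -(ι (Q ε 2) * ι (Q ε 1)) + ι (Q ε 3) := by
  have h := map_Q_mul_map_Q ι 1 2
  simpa [phase, deg, bracket, Fin.sum_univ_four, Pi.single_apply, ZMod.val_one] using h

theorem map_Q_two_three :
    ι (Q ε 2) * ι (Q ε 3) = -(ι (Q ε 3) * ι (Q ε 2)) + ε • ι (Q ε 1) := by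
  have h := map_Q_mul_map_Q ι 2 3
  simpa [phase, deg, bracket, Fin.sum_univ_four, Pi.single_apply, ZMod.val_one] using h

theorem map_Q_three_one : ι (Q ε 3) * ι (Q ε 1) = -(ι (Q ε 1) * ι (Q ε 3)) + ι (Q ε 2) := by
  have h := map_Q_mul_map_Q ι 3 1
  simpa [phase, deg, bracket, Fin.sum_univ_four, Pi.single_apply, ZMod.val_one] using h

theorem map_sub_U (u v : U ε) : ι (u - v) = ι u - ι v := by
  rw [eq_sub_iff_add_eq, ← map_add, sub_add_cancel]

theorem map_neg_U (u : U ε) : ι (-u) = -ι u := by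
  rw [eq_neg_iff_add_eq_zero, ← map_add, neg_add_cancel, map_zero]

theorem map_casimir : ι (casimir ε) = ι (Q ε 0) * ι (Q ε 0) + ε • (ι (Q ε 1) * ι (Q ε 1)) +
    ι (Q ε 2) * ι (Q ε 2) + ι (Q ε 3) * ι (Q ε 3) := by
  simp [casimir, Fin.sum_univ_four, C, Matrix.diagonal_apply]

theorem map_y : ι (y ε) = ε • (ι (Q ε 1) * ι (Q ε 1)) + ι (Q ε 2) * ι (Q ε 2) +
    ι (Q ε 3) * ι (Q ε 3) := by
  rw [y, map_sub_U, map_casimir, map_pow, sq]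
  abel

theorem commute_map_of_commute_map_Q {x : A} (h : ∀ a, Commute x (ι (Q ε a))) (u : U ε) :
    Commute x (ι u) := by
  obtain ⟨v, rfl⟩ := RingQuot.mkAlgHom_surjective K (Rel ε) u
  induction v using FreeAlgebra.induction with
  | grade0 r =>
    rw [AlgHom.commutes, AlgHom.commutes]
    exact (Algebra.commutes r x).symm
  | grade1 a => exact h a
  | mul v w hv hw => rw [map_mul, map_mul]; exact hv.mul_right hw
  | add v w hv hw => rw [map_add, map_add]; exact hv.add_right hw

theorem sq_mul_of_anticomm {p q r : A} (h : p * q = -(q * p) + r) :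
    (q * q) * p = p * (q * q) + (q * r - r * q) := by
  have h' : q * p = -(p * q) + r := by rw [h]; abel
  calc (q * q) * p = q * (q * p) := mul_assoc _ _ _
    _ = -((q * p) * q) + q * r := by rw [h', mul_add, mul_neg, ← mul_assoc, h']
    _ = _ := by rw [h', add_mul, neg_mul, mul_assoc]; abel

theorem commute_map_y (u : U ε) : Commute (ι (y ε)) (ι u) := by
  refine commute_map_of_commute_map_Q ι (fun i => ?_) u
  have h12 := map_Q_one_two ι
  have h23 := map_Q_two_three ι
  have h31 := map_Q_three_one ι
  have h1 := map_Q_zero_mul ι 1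
  have h2 := map_Q_zero_mul ι 2
  have h3 := map_Q_zero_mul ι 3
  rw [map_y, Commute, SemiconjBy]
  have h : i = 0 ∨ i = 1 ∨ i = 2 ∨ i = 3 := by revert i; decide
  rcases h with rfl | rfl | rfl | rfl <;>
    generalize ι (Q ε 0) = d at * <;> generalize ι (Q ε 1) = a at * <;>
    generalize ι (Q ε 2) = b at * <;> generalize ι (Q ε 3) = c at *
  · have k : ∀ {q : A}, d * q = q * d → (q * q) * d = d * (q * q) := fun h => by
      rw [mul_assoc, ← h, ← mul_assoc, ← h, mul_assoc]
    simp only [add_mul, mul_add, smul_mul_assoc, mul_smul_comm, k h1, k h2, k h3]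
  · have h13 : a * c = -(c * a) + b := by rw [h31]; abel
    rw [add_mul, add_mul, sq_mul_of_anticomm h12, sq_mul_of_anticomm h13, smul_mul_assoc,
      mul_add, mul_add, mul_smul_comm, mul_assoc a a a]
    abel
  · have h21 : b * a = -(a * b) + c := by rw [h12]; abel
    rw [add_mul, add_mul, smul_mul_assoc, sq_mul_of_anticomm h21, sq_mul_of_anticomm h23,
      mul_add, mul_add, mul_smul_comm, mul_assoc b b b, mul_smul_comm, smul_mul_assoc, smul_add,
      smul_sub]
    abel
  · have h32 : c * b = -(b * c) + ε • a := by rw [h23]; abel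
    rw [add_mul, add_mul, smul_mul_assoc, sq_mul_of_anticomm h31, sq_mul_of_anticomm h32,
      mul_add, mul_add, mul_smul_comm, mul_assoc c c c, mul_smul_comm, smul_mul_assoc, smul_add,
      smul_sub]
    abel

end A1

namespace ChordTensor

open Function Chord A1

section Untwist

variable {K A : Type*} [Field K] [Ring A] [Algebra K A] {ε : K}

/-- The squares of the quaternion units. -/
def unitSq (ε : K) : Fin 4 → K := ![1, -1, -ε, -ε]

/-- The generators of the enveloping algebra, multiplied by quaternion units. -/
noncomputable def untwist (ι : U ε →ₐ[K] A) (e : Fin 4 → A) (a : Fin 4) : A :=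
  if a = 0 then 1 else ι (Q ε a) * e a

variable {ι : U ε →ₐ[K] A} {e : Fin 4 → A}

theorem untwist_mul (hcomm : ∀ u a, Commute (ι u) (e a)) (a b : Fin 4) :
    (ι (Q ε a) * e a) * (ι (Q ε b) * e b) = (ι (Q ε a) * ι (Q ε b)) * (e a * e b) := by
  rw [mul_assoc, ← mul_assoc (e a), ← (hcomm (Q ε b) a).eq]
  simp only [mul_assoc]

theorem isRep_untwist (hε : ε = 1 ∨ ε = -1) (he : IsUnits e (unitSq ε)) (h12 : e 1 * e 2 = e 3)
    (hcomm : ∀ u a, Commute (ι u) (e a)) : IsRep (untwist ι e) := by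
  have hε2 : ε * ε = 1 := by rcases hε with rfl | rfl <;> simp
  have s1 : e 1 * e 1 = -1 := by simpa [unitSq] using he.mul_self 1
  have s2 : e 2 * e 2 = -(ε • 1) := by
    simpa [unitSq, Algebra.algebraMap_eq_smul_one] using he.mul_self 2
  have h21 : e 2 * e 1 = -e 3 := by
    have h := he.swap 2 1
    rw [h12] at h
    simpa [phase, deg, ZMod.val_one] using h
  have h23 : e 2 * e 3 = ε • e 1 := by
    rw [← neg_neg (e 3), ← h21, mul_neg, ← mul_assoc, s2]
    simp
  have h32 : e 3 * e 2 = -(ε • e 1) := by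
    rw [← h12, mul_assoc, s2]
    simp
  have h31 : e 3 * e 1 = e 2 := by
    rw [← neg_neg (e 3), ← h21, neg_mul, mul_assoc, s1]
    simp
  have h13 : e 1 * e 3 = -e 2 := by
    rw [← h12, ← mul_assoc, s1]
    simp
  have r12 : untwist ι e 1 * untwist ι e 2 = untwist ι e 2 * untwist ι e 1 + untwist ι e 3 := by
    simp only [untwist, show (1 : Fin 4) ≠ 0 by decide, show (2 : Fin 4) ≠ 0 by decide,
      show (3 : Fin 4) ≠ 0 by decide, if_false, untwist_mul hcomm, h12, h21, map_Q_one_two]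
    simp only [add_mul, neg_mul, mul_neg]
  have r23 : untwist ι e 2 * untwist ι e 3 = untwist ι e 3 * untwist ι e 2 + untwist ι e 1 := by
    simp only [untwist, show (1 : Fin 4) ≠ 0 by decide, show (2 : Fin 4) ≠ 0 by decide,
      show (3 : Fin 4) ≠ 0 by decide, if_false, untwist_mul hcomm, h23, h32, map_Q_two_three]
    simp only [add_mul, neg_mul, mul_neg, mul_smul_comm, smul_mul_assoc, smul_add, smul_smul, hε2,
      one_smul, smul_neg]
  have r31 : untwist ι e 3 * untwist ι e 1 = untwist ι e 1 * untwist ι e 3 + untwist ι e 2 := by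
    simp only [untwist, show (1 : Fin 4) ≠ 0 by decide, show (2 : Fin 4) ≠ 0 by decide,
      show (3 : Fin 4) ≠ 0 by decide, if_false, untwist_mul hcomm, h31, h13, map_Q_three_one]
    simp only [add_mul, neg_mul, mul_neg]
  have r0 : untwist ι e 0 = 1 := if_pos rfl
  intro i j
  fin_cases i <;> fin_cases j <;>
    simp [Fin.sum_univ_four, structConst, r0, r12, r23, r31]

/-- The generator of degree zero, separated from the other ones. -/
theorem map_Q_mul_eq (he0 : e 0 = 1) (a : Fin 4) :
    ι (Q ε a) * e a = ι (Q ε 0) ^ (if a = 0 then 1 else 0) * untwist ι e a := by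
  unfold untwist
  by_cases h : a = 0
  · subst h; simp [he0]
  · simp [h]

theorem prod_map_map_Q (he0 : e 0 = 1) (hcomm : ∀ u a, Commute (ι u) (e a)) (P : List ℕ)
    (l : ℕ → Fin 4) :
    ι (P.map fun p => Q ε (l p)).prod * (P.map fun p => e (l p)).prod =
      ι (Q ε 0) ^ (P.map fun p => if l p = 0 then 1 else 0).sum *
        (P.map fun p => untwist ι e (l p)).prod := by
  have hX : ∀ a, Commute (ι (Q ε 0)) (untwist ι e a) := by
    intro a
    unfold untwist
    split_ifs
    · exact Commute.one_right _
    · exact Commute.mul_right (map_Q_zero_mul ι a) (hcomm _ _)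
  induction P with
  | nil => simp
  | cons p P ih =>
    simp only [List.map_cons, List.prod_cons, List.sum_cons, map_mul]
    have h1 : Commute (ι (P.map fun p => Q ε (l p)).prod) (e (l p)) := hcomm _ _
    rw [mul_assoc, ← mul_assoc (ι (List.prod _)), h1.eq, mul_assoc (e (l p)), ih, ← mul_assoc,
      map_Q_mul_eq he0, pow_add, mul_assoc, ← mul_assoc (untwist ι e (l p)),
      ← ((hX (l p)).pow_left _).eq]
    simp only [mul_assoc]

end Untwist

end ChordTensor

namespace ChordTensor

open Function Chord A1

section Weight

variable {K R A : Type*} [Field K] [CommRing R] [Ring A] [Algebra K A] [Algebra R A] {ε : K}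
  {ι : U ε →ₐ[K] A} {e : Fin 4 → A}

theorem C_self (hε : ε = 1 ∨ ε = -1) (a : Fin 4) :
    C ε a a = (if a = 0 then 1 else -ε) * unitSq ε a := by
  rcases hε with rfl | rfl <;> fin_cases a <;> simp [C, unitSq]

theorem algebraMap_chordTensor {κ z : R} {κ' : K} {h : A}
    (hκ : algebraMap R A κ = algebraMap K A κ') (hz : algebraMap R A z = h ^ 2)
    {D : Finset (ℕ × ℕ)} {l : ℕ → Fin 4} (hl : ∀ x ∈ D, l x.2 = l x.1) :
    algebraMap R A (chordTensor κ z D l) =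
      algebraMap K A (∏ x ∈ D, if l x.1 = 0 then 1 else κ') *
        h ^ (∑ x ∈ D, ((if l x.1 = 0 then 1 else 0) + if l x.2 = 0 then 1 else 0)) := by
  induction D using Finset.induction_on with
  | empty => simp [chordTensor]
  | insert x D hx ih =>
    have hxl := hl x (Finset.mem_insert_self _ _)
    rw [chordTensor_insert _ _ hx, map_mul, ih fun z hz => hl z (Finset.mem_insert_of_mem hz),
      Finset.prod_insert hx, Finset.sum_insert hx, map_mul, pow_add, hxl]
    by_cases h0 : l x.1 = 0
    · simp only [h0, metric, if_true, hz, map_one, one_mul]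
      rw [← mul_assoc, ← Algebra.commutes, mul_assoc]
    · simp only [h0, metric, if_true, if_false, hκ, add_zero, pow_zero, one_mul]
      rw [mul_assoc]

/-- The image of the weight of a chord diagram, without signs. -/
theorem map_weightCut (hε : ε = 1 ∨ ε = -1) (he : IsUnits e (unitSq ε)) (he0 : e 0 = 1)
    (hcomm : ∀ u a, Commute (ι u) (e a)) {κ z : R}
    (hκ : algebraMap R A κ = algebraMap K A (-ε)) (hz : algebraMap R A z = ι (Q ε 0) ^ 2)
    {D : Finset (ℕ × ℕ)} (hD : IsDiagram D) (t : ℕ) :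
    ι (weightCut ε t D) = eval R (untwist ι e) (cutOpen t D) (chordTensor κ z D) := by
  rw [eval_cutOpen_eq_sum, weightCut, map_sum]
  refine Finset.sum_congr rfl fun l' _ => ?_
  rw [map_smul, ← Algebra.commutes]
  generalize Chord.extend l' = l
  by_cases hl : ∀ x ∈ D, l x.2 = l x.1
  · have h := prod_map_map_Q (ι := ι) he0 hcomm (cutOpen t D) l
    rw [he.prod_cutOpen hD hl t, ← Algebra.commutes, ← Algebra.smul_def] at h
    have hsum : ((cutOpen t D).map fun p => if l p = 0 then 1 else 0).sum =
        ∑ x ∈ D, ((if l x.1 = 0 then 1 else 0) + if l x.2 = 0 then 1 else 0) := by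
      rw [cutOpen_eq, ← List.sum_toFinset _ (nodup_cutSort _ _), toFinset_cutSort,
        hD.sum_endpoints]
    have hC : ∏ x ∈ D, C ε (l x.1) (l x.2) =
        (∏ x ∈ D, if l x.1 = 0 then 1 else -ε) * ∏ x ∈ D, unitSq ε (l x.1) := by
      rw [← Finset.prod_mul_distrib]
      exact Finset.prod_congr rfl fun x hx => by rw [hl x hx, C_self hε]
    rw [algebraMap_chordTensor hκ hz hl, ← hsum, mul_assoc, ← h, ← Algebra.smul_def, smul_smul, hC]
    congr 1
    rw [crossingSign]
    ring
  · push Not at hl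
    obtain ⟨x, hx, hne⟩ := hl
    have h1 : ∏ x ∈ D, C ε (l x.1) (l x.2) = 0 :=
      Finset.prod_eq_zero hx (Matrix.diagonal_apply_ne _ hne.symm)
    have h2 : chordTensor κ z D l = 0 :=
      Finset.prod_eq_zero hx (if_neg hne.symm)
    rw [h1, h2, zero_mul, zero_smul, map_zero, zero_mul]

theorem casimir_untwist (hε : ε = 1 ∨ ε = -1) (he : IsUnits e (unitSq ε))
    (hcomm : ∀ u a, Commute (ι u) (e a)) {κ y : R}
    (hκ : algebraMap R A κ = algebraMap K A (-ε)) (hy : algebraMap R A y = ι (A1.y ε)) :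
    κ • (untwist ι e 1 * untwist ι e 1 + untwist ι e 2 * untwist ι e 2 +
      untwist ι e 3 * untwist ι e 3) = algebraMap R A y := by
  have hsq : ∀ a, a ≠ 0 → untwist ι e a * untwist ι e a =
      unitSq ε a • (ι (Q ε a) * ι (Q ε a)) := by
    intro a ha
    rw [untwist, if_neg ha, untwist_mul hcomm, he.mul_self, ← Algebra.commutes, Algebra.smul_def]
  have hε2 : ε * ε = 1 := by rcases hε with rfl | rfl <;> simp
  rw [hsq 1 (by decide), hsq 2 (by decide), hsq 3 (by decide), Algebra.smul_def, hκ,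
    ← Algebra.smul_def, hy, map_y]
  simp [unitSq, smul_smul, hε2]

end Weight

end ChordTensor

/-! ### The quaternion units -/

namespace A1

open TensorProduct Quaternion

variable {K : Type*} [Field K] (ε : K)

/-- The units `1, i, j, k` of the quaternion algebra with `i² = -1`, `j² = -ε`. -/
def quaternionUnit : Fin 4 → ℍ[K,-1,0,-ε] :=
  ![1, ⟨0, 1, 0, 0⟩, ⟨0, 0, 1, 0⟩, ⟨0, 0, 0, 1⟩]

theorem quaternionUnit_swap (a b : Fin 4) : quaternionUnit ε a * quaternionUnit ε b =
    phase K a b • (quaternionUnit ε b * quaternionUnit ε a) := by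
  have h := ZMod.val_one 2
  fin_cases a <;> fin_cases b <;>
    ext <;> simp [quaternionUnit, phase, deg, h]

theorem quaternionUnit_mul_self (a : Fin 4) :
    quaternionUnit ε a * quaternionUnit ε a =
      algebraMap K _ (ChordTensor.unitSq ε a) := by
  fin_cases a <;> ext <;> simp [quaternionUnit, ChordTensor.unitSq]

/-- The enveloping algebra embeds into an algebra that contains commuting quaternion units. -/
theorem exists_untwisting.{u} {K : Type u} [Field K] (ε : K) (hε : ε = 1 ∨ ε = -1) :
    ∃ (A : Type u) (_ : Ring A) (_ : Algebra K A) (ι : U ε →ₐ[K] A) (e : Fin 4 → A),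
      Function.Injective ι ∧ ChordTensor.IsUnits e (ChordTensor.unitSq ε) ∧ e 0 = 1 ∧
      e 1 * e 2 = e 3 ∧ (∀ u a, Commute (ι u) (e a)) ∧
      ∀ u, (∀ v, Commute (ι u) (ι v)) → ∀ x, Commute (ι u) x := by
  refine ⟨U ε ⊗[K] ℍ[K,-1,0,-ε], inferInstance, inferInstance,
    Algebra.TensorProduct.includeLeft, fun a => 1 ⊗ₜ quaternionUnit ε a,
    Algebra.TensorProduct.includeLeft_injective (algebraMap K _).injective,
    ⟨fun a b => ?_, fun a => ?_, fun a => ?_⟩, ?_, ?_, fun u a => ?_, fun u hu x => ?_⟩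
  · rw [Algebra.TensorProduct.tmul_mul_tmul, Algebra.TensorProduct.tmul_mul_tmul,
      quaternionUnit_swap, TensorProduct.tmul_smul]
  · rw [Algebra.TensorProduct.tmul_mul_tmul, quaternionUnit_mul_self, one_mul,
      Algebra.TensorProduct.algebraMap_apply']
  · rcases hε with rfl | rfl <;> fin_cases a <;> simp [ChordTensor.unitSq]
  · rfl
  · rw [Algebra.TensorProduct.tmul_mul_tmul, one_mul]
    congr 1
    ext <;> simp [quaternionUnit]
  · simp [Commute, SemiconjBy]
  · induction x using TensorProduct.induction_on with
    | zero => exact Commute.zero_right _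
    | tmul v q =>
      have h := congrArg (· * (1 ⊗ₜ[K] q : U ε ⊗[K] ℍ[K,-1,0,-ε])) (hu v).eq
      simpa [Commute, SemiconjBy] using h
    | add x x' hx hx' => exact hx.add_right hx'

end A1

namespace ChordTensor

open Chord

variable {K : Type*} [Field K] (a : ℕ × ℕ) {b b' : ℕ × ℕ} {D : Finset (ℕ × ℕ)}

theorem leftEnd_mem : leftEnd a b = b.1 ∨ leftEnd a b = b.2 := by
  unfold leftEnd; split_ifs <;> simp

theorem rightEnd_mem : rightEnd a b = b.1 ∨ rightEnd a b = b.2 := by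
  unfold rightEnd; split_ifs <;> simp

/-- Joining ends of two chords that are removed gives a diagram. -/
theorem isDiagram_insert_join_erase₃ (hD : IsDiagram D) (hb : b ∈ D) (hb' : b' ∈ D)
    (hbb' : b ≠ b') {u v : ℕ} (hu : u = b.1 ∨ u = b.2) (hv : v = b'.1 ∨ v = b'.2) :
    IsDiagram (insert (join u v) (erase₃ D a b b')) ∧ u ∉ endpoints (erase₃ D a b b') ∧
      v ∉ endpoints (erase₃ D a b b') ∧ u ≠ v := by
  have hsub : erase₃ D a b b' ⊆ D :=
    (Finset.erase_subset _ _).trans ((Finset.erase_subset _ _).trans (Finset.erase_subset _ _))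
  have h := hD.notMem_endpoints hsub hb (by simp [erase₃])
  have h' := hD.notMem_endpoints hsub hb' (by simp [erase₃])
  have hne := hD.2 b hb b' hb' hbb'
  have hu' : u ∉ endpoints (erase₃ D a b b') := by
    rcases hu with rfl | rfl
    exacts [h.1, h.2]
  have hv' : v ∉ endpoints (erase₃ D a b b') := by
    rcases hv with rfl | rfl
    exacts [h'.1, h'.2]
  have huv : u ≠ v := by
    rcases hu with rfl | rfl <;> rcases hv with rfl | rfl
    exacts [hne.1, hne.2.1, hne.2.2.1, hne.2.2.2]
  exact ⟨(hD.mono hsub).insert_join huv hu' hv', hu', hv', huv⟩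

theorem isDiagram_insert_join_insert_join_erase₃ (hD : IsDiagram D) (hb : b ∈ D) (hb' : b' ∈ D)
    (hbb' : b ≠ b') {u v u' v' : ℕ} (hu : u = b.1 ∨ u = b.2) (hv : v = b'.1 ∨ v = b'.2)
    (hu' : u' = b.1 ∨ u' = b.2) (hv' : v' = b'.1 ∨ v' = b'.2) (huu' : u ≠ u') (hvv' : v ≠ v') :
    IsDiagram (insert (join u v) (insert (join u' v') (erase₃ D a b b'))) := by
  obtain ⟨-, h1, h2, h3⟩ := isDiagram_insert_join_erase₃ a hD hb hb' hbb' hu hv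
  obtain ⟨h4, -⟩ := isDiagram_insert_join_erase₃ a hD hb hb' hbb' hu' hv'
  obtain ⟨-, -, -, h5⟩ := isDiagram_insert_join_erase₃ a hD hb hb' hbb' hu hv'
  obtain ⟨-, -, -, h6⟩ := isDiagram_insert_join_erase₃ a hD hb hb' hbb' hu' hv
  refine h4.insert_join h3 ?_ ?_ <;> rw [mem_endpoints_insert_join] <;>
    simp only [huu', h1, h2, h5, hvv', h6.symm, or_self, not_false_eq_true]

end ChordTensor

/-- The recurrence for the unframed `A1_ε` weight system, whatever points `cut` are chosen for
cutting the diagrams open. -/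
theorem mainTheorem8 {K : Type*} [Field K] [CharZero K] (ε : K) (hε : ε = 1 ∨ ε = -1)
    (cut : Finset (ℕ × ℕ) → ℕ)
    (D : Finset (ℕ × ℕ)) (hD : Chord.IsDiagram D) (a : ℕ × ℕ) (ha : a ∈ D)
    (k : ℕ) (b : Fin k → ℕ × ℕ) (hb : Function.Injective b)
    (hb_range : ∀ x, x ∈ Set.range b ↔ x ∈ D ∧ Chord.Crosses a x) :
    Chord.weightBar ε cut (Chord.diag K D) =
      -(ε • ((k : K) • Chord.weightBar ε cut (Chord.diag K (D.erase a))
        + A1.y ε * ∑ i, Chord.weightBar ε cut (Chord.diag K ((D.erase a).erase (b i)))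
        - ∑ i, ∑ j ∈ Finset.Ioi i, Chord.weightBar ε cut (Chord.Γ K D a (b i) (b j))
        + A1.y ε * ∑ i, ∑ j ∈ Finset.Ioi i,
            Chord.weightBar ε cut (Chord.Λ K D a (b i) (b j)))) := by
  obtain ⟨A, _, _, ι, e, hι, he, he0, h12, hcomm, hcen⟩ := A1.exists_untwisting ε hε
  have hcentral : ∀ u, (∀ v, Commute (ι u) (ι v)) → ι u ∈ Subring.center A := fun u hu =>
    Subring.mem_center_iff.2 fun x => (hcen u hu x).eq.symm
  let y : Subring.center A := ⟨ι (A1.y ε), hcentral _ (A1.commute_map_y ι)⟩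
  let z : Subring.center A := ⟨ι (A1.Q ε 0) ^ 2, (Subring.center A).pow_mem (hcentral _
    (A1.commute_map_of_commute_map_Q ι (A1.map_Q_zero_mul ι))) 2⟩
  let κ : Subring.center A := ⟨algebraMap K A (-ε), Subring.mem_center_iff.2 fun x =>
    (Algebra.commutes _ x).symm⟩
  have hX := ChordTensor.isRep_untwist (ι := ι) hε he h12 hcomm
  have h0 : ChordTensor.untwist ι e 0 = 1 := if_pos rfl
  have hy := ChordTensor.casimir_untwist (R := Subring.center A) (κ := κ) (y := y) hε he hcomm
    rfl rfl
  have h2 : ∀ u v : A, 2 * u = 2 * v → u = v := by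
    intro u v h
    have h' := congrArg (fun x => (2⁻¹ : K) • x) h
    simpa only [two_mul, ← two_smul K, smul_smul, inv_mul_cancel₀ (two_ne_zero (α := K)),
      one_smul] using h'
  have hw : ∀ D, Chord.IsDiagram D → ι (Chord.weightBar ε cut (Chord.diag K D)) =
      ChordTensor.wt (ChordTensor.untwist ι e) κ (-y) D := by
    intro D hD
    refine ChordTensor.map_φ_diag hX h0 (z := z) hy h2 (ι.toLinearMap ∘ₗ Chord.weight ε cut)
      (fun D hD => ?_) hD
    rw [LinearMap.comp_apply, Chord.weight, Finsupp.linearCombination_single, one_smul,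
      AlgHom.toLinearMap_apply,
      ChordTensor.map_weightCut (R := Subring.center A) hε he he0 hcomm (κ := κ) (z := z) rfl rfl hD,
      Chord.cutOpen_eq, ChordTensor.eval_cutSort hX _ _ hD]
  have hD' := hD.mono (Finset.erase_subset a D)
  have hb1 : ∀ i, b i ∈ D := fun i => ((hb_range _).1 ⟨i, rfl⟩).1
  have hlr := fun i => Chord.leftEnd_ne_rightEnd a (hD.1 _ (hb1 i))
  have key := ChordTensor.two_smul_wt hX h0 hy hD ha hb hb_range
  rw [two_smul, two_smul, ← two_mul, ← two_mul] at key
  replace key := h2 _ _ key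
  have hs1 : ∀ c : A, κ • c = -(ε • c) := by
    intro c
    change algebraMap K A (-ε) * c = _
    rw [← Algebra.smul_def, neg_smul]
  have hs2 : ∀ c : A, y • c = ι (A1.y ε) * c := fun c => rfl
  refine hι ?_
  rw [hw D hD, key, hs1, A1.map_neg_U, map_smul, map_add, A1.map_sub_U, map_add, map_mul, map_mul,
    map_smul, hw _ hD', map_sum, map_sum, map_sum, hs2, hs2, Nat.cast_smul_eq_nsmul,
    Nat.cast_smul_eq_nsmul]
  have hne : ∀ i, ∀ j ∈ Finset.Ioi i, b i ≠ b j := fun i j hij h =>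
    (Finset.mem_Ioi.1 hij).ne (hb h)
  congr 5
  · exact congrArg _ (Finset.sum_congr rfl fun i _ =>
      (hw _ (hD'.mono (Finset.erase_subset _ _))).symm)
  · funext i
    rw [map_sum]
    refine Finset.sum_congr rfl fun j hj => ?_
    rw [Chord.Γ, map_sub, A1.map_sub_U, Chord.parallel, Chord.crossed, hw, hw]
    · exact ChordTensor.isDiagram_insert_join_insert_join_erase₃ a hD (hb1 i) (hb1 j) (hne i j hj)
        (ChordTensor.leftEnd_mem a) (ChordTensor.rightEnd_mem a) (ChordTensor.rightEnd_mem a)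
        (ChordTensor.leftEnd_mem a) (hlr i) (hlr j).symm
    · exact ChordTensor.isDiagram_insert_join_insert_join_erase₃ a hD (hb1 i) (hb1 j) (hne i j hj)
        (ChordTensor.leftEnd_mem a) (ChordTensor.leftEnd_mem a) (ChordTensor.rightEnd_mem a)
        (ChordTensor.rightEnd_mem a) (hlr i) (hlr j)
  · funext i
    rw [map_sum]
    refine Finset.sum_congr rfl fun j hj => ?_
    have h := fun {u v} => ChordTensor.isDiagram_insert_join_erase₃ a hD (hb1 i) (hb1 j)
      (hne i j hj) (u := u) (v := v)
    rw [Chord.Λ, map_sub, A1.map_sub_U, map_sub, A1.map_sub_U, map_add, map_add, hw, hw, hw, hw]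
    · exact (h (ChordTensor.rightEnd_mem a) (ChordTensor.rightEnd_mem a)).1
    · exact (h (ChordTensor.leftEnd_mem a) (ChordTensor.leftEnd_mem a)).1
    · exact (h (ChordTensor.rightEnd_mem a) (ChordTensor.leftEnd_mem a)).1
    · exact (h (ChordTensor.leftEnd_mem a) (ChordTensor.rightEnd_mem a)).1
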